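/- Let $X_2=\operatorname{GL}_2(\mathbb R)/\operatorname{GL}_2(\mathbb Z)$, with the quotient topology, be the space of lattices $\Lambda=g\mathbb Z^2$ in $\mathbb R^2$, and let $d(\Lambda)=|\det g|$ be the covolume. A *domain* here means a non-empty, open, bounded, convex set $K\subset\mathbb R^2$ with $K=-K$. A lattice $\Lambda$ is *$K$-admissible* if $\Lambda\cap K=\{0\}$; put $\Delta(K)=\inf\{d(\Lambda):\Lambda\ \text{is}\ K\text{-admissible}\}$, and let the *critical locus* $\mathcal L(K)\subset X_2$ be the set of $K$-admissible lattices $\Lambda$ with $d(\Lambda)=\Delta(K)$. A domain $K$ is *irreducible* if $\Delta(K')<\Delta(K)$ for every domain $K'\subsetneq K$, and *strictly convex* if the line joining two distinct points of $\partial K$ meets $\partial K$ in no other point. **Theorem.** Let $H\subset\mathbb R^2$ be a strictly convex irreducible domain. Then $\mathcal L(H)$ is an embedded circle in $X_2$, that is, the image of a topological embedding $\mathbb S^1\to X_2$; and for every non-empty closed subset $Z$ of $\mathcal L(H)$ there is a domain $K\supseteq H$ with $\mathcal L(K)=Z$. -/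

import Mathlib

open scoped Matrix

/-- The subgroup `GL₂(ℤ)` of `GL₂(ℝ)`: the invertible integer matrices with integer inverse. -/
def integralGL2 : Subgroup (GL (Fin 2) ℝ) :=
  (Matrix.GeneralLinearGroup.map (n := Fin 2) (Int.castRingHom ℝ)).range

/-- The space `X₂ = GL₂(ℝ) / GL₂(ℤ)` of lattices in `ℝ²`; the class of `g` is the lattice `g ℤ²`.
It carries the quotient topology. -/
abbrev LatticeSpace : Type := GL (Fin 2) ℝ ⧸ integralGL2

/-- The lattice `g ℤ²`, as a subset of `ℝ²`. The plane is `Fin 2 → ℝ`: only its topology,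
its bounded sets and its linear structure are used. -/
def latticeOfMatrix (g : GL (Fin 2) ℝ) : Set (Fin 2 → ℝ) :=
  Set.range fun n : Fin 2 → ℤ => (g : Matrix (Fin 2) (Fin 2) ℝ) *ᵥ fun i => (n i : ℝ)

theorem latticeOfMatrix_mul_map_subset (g : GL (Fin 2) ℝ) (u : GL (Fin 2) ℤ) :
    latticeOfMatrix (g * Matrix.GeneralLinearGroup.map (Int.castRingHom ℝ) u)
      ⊆ latticeOfMatrix g := by
  rintro _ ⟨n, rfl⟩
  refine ⟨(u : Matrix (Fin 2) (Fin 2) ℤ) *ᵥ n, ?_⟩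
  simp only [Units.val_mul, ← Matrix.mulVec_mulVec]
  congr 1
  ext i
  simp [Matrix.mulVec, dotProduct, Matrix.GeneralLinearGroup.map]

theorem latticeOfMatrix_eq_of_rel (g h : GL (Fin 2) ℝ)
    (hgh : QuotientGroup.leftRel integralGL2 g h) : latticeOfMatrix g = latticeOfMatrix h := by
  rw [QuotientGroup.leftRel_apply] at hgh
  obtain ⟨u, hu⟩ := hgh
  have h1 : h = g * Matrix.GeneralLinearGroup.map (Int.castRingHom ℝ) u := by rw [hu]; group
  have h2 : g = h * Matrix.GeneralLinearGroup.map (Int.castRingHom ℝ) u⁻¹ := by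
    rw [map_inv, hu]; group
  apply Set.Subset.antisymm
  · conv_lhs => rw [h2]
    exact latticeOfMatrix_mul_map_subset h u⁻¹
  · conv_lhs => rw [h1]
    exact latticeOfMatrix_mul_map_subset g u

theorem abs_det_eq_of_rel (g h : GL (Fin 2) ℝ) (hgh : QuotientGroup.leftRel integralGL2 g h) :
    |(g : Matrix (Fin 2) (Fin 2) ℝ).det| = |(h : Matrix (Fin 2) (Fin 2) ℝ).det| := by
  rw [QuotientGroup.leftRel_apply] at hgh
  obtain ⟨u, hu⟩ := hgh
  have h1 : h = g * Matrix.GeneralLinearGroup.map (Int.castRingHom ℝ) u := by rw [hu]; group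
  have h2 : |((Matrix.GeneralLinearGroup.map (Int.castRingHom ℝ) u : GL (Fin 2) ℝ) :
      Matrix (Fin 2) (Fin 2) ℝ).det| = 1 := by
    have h3 : ((Matrix.GeneralLinearGroup.map (Int.castRingHom ℝ) u : GL (Fin 2) ℝ) :
        Matrix (Fin 2) (Fin 2) ℝ).det = (((u : Matrix (Fin 2) (Fin 2) ℤ).det : ℤ) : ℝ) := by
      simp [Matrix.det_fin_two, Matrix.GeneralLinearGroup.map]
    have h4 : IsUnit (u : Matrix (Fin 2) (Fin 2) ℤ).det :=
      (Matrix.isUnit_iff_isUnit_det _).1 u.isUnit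
    rw [h3, ← Int.cast_abs, Int.isUnit_iff_abs_eq.1 h4, Int.cast_one]
  rw [h1, Units.val_mul, Matrix.det_mul, abs_mul, h2, mul_one]

/-- The set of points of a lattice `Λ ∈ X₂`. -/
def latticePoints (Λ : LatticeSpace) : Set (Fin 2 → ℝ) :=
  Quotient.lift latticeOfMatrix latticeOfMatrix_eq_of_rel Λ

/-- The covolume `d(Λ)`: `|det g|` for `Λ = g ℤ²`. -/
noncomputable def latticeCovolume (Λ : LatticeSpace) : ℝ :=
  Quotient.lift (fun g : GL (Fin 2) ℝ => |(g : Matrix (Fin 2) (Fin 2) ℝ).det|)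
    abs_det_eq_of_rel Λ

/-- A bounded convex domain (non-empty open set) in `ℝ²`, symmetric about the origin. -/
structure IsSymmetricConvexDomain (K : Set (Fin 2 → ℝ)) : Prop where
  isOpen : IsOpen K
  nonempty : K.Nonempty
  convex : Convex ℝ K
  isBounded : Bornology.IsBounded K
  neg_mem : ∀ v ∈ K, -v ∈ K

/-- `Λ` is `K`-admissible: `Λ ∩ K = {0}`. -/
def IsAdmissible (K : Set (Fin 2 → ℝ)) (Λ : LatticeSpace) : Prop :=
  latticePoints Λ ∩ K = {0}

/-- The critical determinant `Δ(K)`: the infimum of the covolumes of `K`-admissible lattices. -/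
noncomputable def criticalDeterminant (K : Set (Fin 2 → ℝ)) : ℝ :=
  sInf (latticeCovolume '' {Λ | IsAdmissible K Λ})

/-- The critical locus `𝓛(K)`: the set of `K`-critical lattices, that is, of the `K`-admissible
lattices of covolume `Δ(K)`. -/
def criticalLocus (K : Set (Fin 2 → ℝ)) : Set LatticeSpace :=
  {Λ | IsAdmissible K Λ ∧ latticeCovolume Λ = criticalDeterminant K}

/-- `K` is irreducible: every symmetric bounded convex domain properly contained in `K` has a
strictly smaller critical determinant. -/
def IsIrreducibleDomain (K : Set (Fin 2 → ℝ)) : Prop :=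
  ∀ H : Set (Fin 2 → ℝ), IsSymmetricConvexDomain H → H ⊂ K →
    criticalDeterminant H < criticalDeterminant K

/-- Strict convexity of a convex domain: the line joining two distinct points of the boundary meets
the boundary at no other point. (Mathlib's `StrictConvex` holds for every open convex set.) -/
def HasStrictlyConvexBoundary (H : Set (Fin 2 → ℝ)) : Prop :=
  ∀ x ∈ frontier H, ∀ y ∈ frontier H, x ≠ y →
    ∀ z ∈ line[ℝ, x, y], z ∈ frontier H → z = x ∨ z = y

/-! Write `N` for the gauge of a domain. The basic objects are inscribed hexagons: unit vectors `p`,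
`q` with `q - p` a unit vector, which together with their negatives are the vertices. Such a pair
spans an admissible lattice (`IsHexPair.one_le`). Conversely, scale a shortest vector of an
admissible lattice to a unit vector `p`. If the covolume were smaller than that of the hexagon at
`p`, scaled back, the next lattice line would contain a shorter vector
(`IsAdmissible.exists_isHexPair`). So the critical determinant is the infimum of the hexagon
determinants. Under strict convexity each boundary point carries exactly one positively ordered
hexagon (`IsHexPair.unique`), and critical lattices come from hexagons.

Irreducibility makes every hexagon critical (`IsHexPair.planeDet_eq`). Cutting a thin cap off at `p`
lowers the critical determinant, so the remaining domain has an inscribed hexagon of determinant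
below that of the whole; it must have a vertex on the cut. As the cap shrinks, strict convexity
drives this vertex to `p`, and in the limit the hexagon at `p` has at most the critical determinant.

Hence the critical locus is the image of the boundary under vertex ↦ lattice. The only unit vectors
of a hexagon's lattice are its six vertices, and a half-open arc from `p₀` to `q₀` contains exactly
one of them (`IsHexPair.exists_mem_sector`, `IsHexPair.sector_injective`). The two ends of the arc
give the same lattice, so the arc closes up to a circle.

For closed `Z`, let `S` be the set of vertices of its hexagons and `K` the set of points strictly
inside all supporting strips at `S`, truncated. Then `K` contains the boundary points of `H` outside
`S` and none in `S`. So the critical lattices of `H` that stay admissible are those in `Z`, and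
since `Z` is non-empty the critical determinant is unchanged. -/

/-! ### Plane determinants. -/

/-- The determinant of the pair `(a, b)` of plane vectors. -/
def planeDet (a b : Fin 2 → ℝ) : ℝ := a 0 * b 1 - a 1 * b 0

theorem planeDet_add_right (a b c : Fin 2 → ℝ) :
    planeDet a (b + c) = planeDet a b + planeDet a c := by
  simp [planeDet]; ring

theorem planeDet_sub_right (a b c : Fin 2 → ℝ) :
    planeDet a (b - c) = planeDet a b - planeDet a c := by
  simp [planeDet]; ring

theorem planeDet_smul_right (r : ℝ) (a b : Fin 2 → ℝ) :
    planeDet a (r • b) = r * planeDet a b := by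
  simp [planeDet]; ring

theorem planeDet_smul_left (r : ℝ) (a b : Fin 2 → ℝ) :
    planeDet (r • a) b = r * planeDet a b := by
  simp [planeDet]; ring

theorem planeDet_neg_right (a b : Fin 2 → ℝ) : planeDet a (-b) = -planeDet a b := by
  simp [planeDet]; ring

theorem planeDet_self (a : Fin 2 → ℝ) : planeDet a a = 0 := by
  simp [planeDet, mul_comm]

theorem planeDet_combination (p q : Fin 2 → ℝ) (a b c d : ℝ) :
    planeDet (a • p + b • q) (c • p + d • q) = (a * d - b * c) * planeDet p q := by
  simp [planeDet]; ring

theorem Continuous.planeDet {X : Type*} [TopologicalSpace X] {f g : X → Fin 2 → ℝ}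
    (hf : Continuous f) (hg : Continuous g) : Continuous fun x => planeDet (f x) (g x) := by
  unfold _root_.planeDet
  fun_prop

theorem eq_combination_of_planeDet_ne_zero {p q : Fin 2 → ℝ} (h : planeDet p q ≠ 0)
    (x : Fin 2 → ℝ) :
    x = (planeDet x q / planeDet p q) • p + (planeDet p x / planeDet p q) • q := by
  have h1 : planeDet p q • x = planeDet x q • p + planeDet p x • q := by
    ext i
    fin_cases i <;> simp [planeDet] <;> ring
  rw [div_eq_inv_mul, div_eq_inv_mul, mul_smul, mul_smul, ← smul_add, ← h1, smul_smul,
    inv_mul_cancel₀ h, one_smul]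

theorem left_ne_zero_of_planeDet_ne_zero {p q : Fin 2 → ℝ} (h : planeDet p q ≠ 0) : p ≠ 0 := by
  rintro rfl
  simp [planeDet] at h

theorem combination_ne_zero {p q : Fin 2 → ℝ} (h : planeDet p q ≠ 0) {a b : ℝ}
    (hab : a ≠ 0 ∨ b ≠ 0) : a • p + b • q ≠ 0 := by
  intro h0
  have h1 : planeDet p (a • p + b • q) = b * planeDet p q := by
    rw [planeDet_add_right, planeDet_smul_right, planeDet_smul_right, planeDet_self]; ring
  have h2 : planeDet (a • p + b • q) q = a * planeDet p q := by
    simp [planeDet]; ring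
  rw [h0] at h1 h2
  have h3 : b * planeDet p q = 0 := by rw [← h1]; simp [planeDet]
  have h4 : a * planeDet p q = 0 := by rw [← h2]; simp [planeDet]
  simp only [mul_eq_zero, h, or_false] at h3 h4
  tauto

/-! ### Norms and inscribed hexagons. -/

/-- A norm on the plane, as a bare function. -/
structure IsPlaneNorm (N : (Fin 2 → ℝ) → ℝ) : Prop where
  continuous : Continuous N
  add_le : ∀ x y, N (x + y) ≤ N x + N y
  smul : ∀ (c : ℝ) x, N (c • x) = |c| * N x
  pos : ∀ x, x ≠ 0 → 0 < N x

/-- Strict convexity of the unit ball of `N`. -/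
def IsStrictNorm (N : (Fin 2 → ℝ) → ℝ) : Prop :=
  ∀ x y, N x = 1 → N y = 1 → x ≠ y → ∀ s t : ℝ, 0 < s → 0 < t → s + t = 1 →
    N (s • x + t • y) < 1

/-- `p, q, q - p, -p, -q, p - q` are the vertices, in positive order, of a hexagon inscribed in
the unit sphere of `N`. -/
structure IsHexPair (N : (Fin 2 → ℝ) → ℝ) (p q : Fin 2 → ℝ) : Prop where
  left : N p = 1
  right : N q = 1
  sub : N (q - p) = 1
  pos : 0 < planeDet p q

theorem IsPlaneNorm.zero {N : (Fin 2 → ℝ) → ℝ} (hN : IsPlaneNorm N) : N 0 = 0 := by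
  simpa using hN.smul 0 0

theorem IsPlaneNorm.nonneg {N : (Fin 2 → ℝ) → ℝ} (hN : IsPlaneNorm N) (x : Fin 2 → ℝ) :
    0 ≤ N x := by
  rcases eq_or_ne x 0 with rfl | h
  · exact hN.zero.ge
  · exact (hN.pos x h).le

theorem IsPlaneNorm.neg {N : (Fin 2 → ℝ) → ℝ} (hN : IsPlaneNorm N) (x : Fin 2 → ℝ) :
    N (-x) = N x := by
  simpa using hN.smul (-1) x

theorem IsPlaneNorm.smul_of_nonneg {N : (Fin 2 → ℝ) → ℝ} (hN : IsPlaneNorm N) {c : ℝ}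
    (hc : 0 ≤ c) (x : Fin 2 → ℝ) : N (c • x) = c * N x := by
  rw [hN.smul, abs_of_nonneg hc]

theorem IsPlaneNorm.combination_le {N : (Fin 2 → ℝ) → ℝ} (hN : IsPlaneNorm N) {s t : ℝ}
    (hs : 0 ≤ s) (ht : 0 ≤ t) (x y : Fin 2 → ℝ) : N (s • x + t • y) ≤ s * N x + t * N y := by
  have := hN.add_le (s • x) (t • y)
  rwa [hN.smul_of_nonneg hs, hN.smul_of_nonneg ht] at this

theorem IsHexPair.ne_zero {N : (Fin 2 → ℝ) → ℝ} {p q : Fin 2 → ℝ} (h : IsHexPair N p q) :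
    planeDet p q ≠ 0 := h.pos.ne'

/-- A sixth of a turn of the hexagon: what is proved for one vertex or sector transfers to all six.
-/
theorem IsHexPair.rotate {N : (Fin 2 → ℝ) → ℝ} (hN : IsPlaneNorm N) {p q : Fin 2 → ℝ}
    (h : IsHexPair N p q) : IsHexPair N q (q - p) where
  left := h.right
  right := h.sub
  sub := by rw [sub_sub_cancel_left, hN.neg, h.left]
  pos := by
    have := h.pos
    simp only [planeDet, Pi.sub_apply] at this ⊢
    linarith

theorem planeDet_rotate (p q : Fin 2 → ℝ) : planeDet q (q - p) = planeDet p q := by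
  simp [planeDet]; ring

/-- The effect of the sixth of a turn on coordinates; a general ring covers lattice points over `ℤ`
and sectors over `ℝ`. -/
theorem combination_rotate {R : Type*} [Ring R] [Module R (Fin 2 → ℝ)] (x y : R)
    (p q : Fin 2 → ℝ) : (x + y) • q + (-x) • (q - p) = x • p + y • q := by
  rw [add_smul, smul_sub, neg_smul, neg_smul]
  abel

theorem IsHexPair.neg {N : (Fin 2 → ℝ) → ℝ} (hN : IsPlaneNorm N) {p q : Fin 2 → ℝ}
    (h : IsHexPair N p q) : IsHexPair N (-p) (-q) := by
  have := ((h.rotate hN).rotate hN).rotate hN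
  have e : q - p - q - (q - p) = -q := by abel
  rwa [sub_sub_cancel_left, ← sub_sub_cancel_left q p, e, sub_sub_cancel_left] at this

/-- Six half-open sectors, permuted by `(x, y) ↦ (x + y, -x)`, cover the punctured plane. -/
theorem sector_induction {R : Type*} [Ring R] [LinearOrder R] [IsStrictOrderedRing R]
    {T : R → R → Prop} (base : ∀ x y, 0 < x → 0 ≤ y → T x y)
    (step : ∀ x y, T (x + y) (-x) → T x y) (x y : R) (h : x ≠ 0 ∨ y ≠ 0) : T x y := by
  -- The map has order six; the iterates are `(x + y, -x)`, `(y, -x - y)`, `(-x, -y)`, `(-x - y,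
  -- x)`, `(-y, x + y)`.
  have h1 := step x y
  have h2 := step (x + y) (-x)
  have h3 := step y (-(x + y))
  have h4 := step (-x) (-y)
  have h5 := step (-x + -y) x
  have e2 : x + y + -x = y := by abel
  have e3 : y + -(x + y) = -x := by abel
  have e5 : -x + -y + x = -y := by abel
  have e6 : -(-x + -y) = x + y := by abel
  rw [e2] at h2
  rw [e3] at h3
  rw [neg_neg] at h4
  rw [e5, e6] at h5
  rcases lt_trichotomy x 0 with hx | hx | hx
  · rcases lt_or_ge 0 (x + y) with hs | hs
    · exact h1 (base _ _ hs (neg_nonneg.2 hx.le))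
    · rcases lt_or_ge 0 y with hy | hy
      · exact h1 (h2 (base _ _ hy (neg_nonneg.2 hs)))
      · exact h1 (h2 (h3 (base _ _ (neg_pos.2 hx) (neg_nonneg.2 hy))))
  · subst hx
    rcases lt_trichotomy y 0 with hy | hy | hy
    · refine h1 (h2 (h3 (h4 (base _ _ ?_ le_rfl))))
      simpa using hy
    · simp [hy] at h
    · refine h1 (base _ _ ?_ ?_) <;> simp [hy]
  · rcases le_or_gt 0 y with hy | hy
    · exact base _ _ hx hy
    · rcases lt_or_ge (x + y) 0 with hs | hs
      · refine h1 (h2 (h3 (h4 (base _ _ ?_ hx.le))))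
        have := neg_pos.2 hs
        rwa [neg_add] at this
      · exact h1 (h2 (h3 (h4 (h5 (base _ _ (neg_pos.2 hy) hs)))))

/-- In the sector of a hexagon, both coordinates are bounded by the norm. -/
theorem IsHexPair.coord_le {N : (Fin 2 → ℝ) → ℝ} (hN : IsPlaneNorm N) {p q : Fin 2 → ℝ}
    (h : IsHexPair N p q) {x y : ℝ} (hx : 0 ≤ x) (hy : 0 ≤ y) :
    x ≤ N (x • p + y • q) ∧ y ≤ N (x • p + y • q) := by
  -- Sliding along the unit vector `q - p` to either edge of the sector costs `y`, respectively `x`,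
  -- out of `x + y`.
  have e1 : (x + y) • p = (x • p + y • q) + (-y) • (q - p) := by module
  have e2 : (x + y) • q = (x • p + y • q) + x • (q - p) := by module
  have h1 := hN.add_le (x • p + y • q) ((-y) • (q - p))
  have h2 := hN.add_le (x • p + y • q) (x • (q - p))
  rw [← e1, hN.smul, hN.smul, h.left, h.sub, abs_neg, abs_of_nonneg hy,
    abs_of_nonneg (by positivity)] at h1
  rw [← e2, hN.smul, hN.smul, h.right, h.sub, abs_of_nonneg hx,
    abs_of_nonneg (by positivity)] at h2
  constructor <;> linarith

/-- Rotation brings the lattice point to a sector where `m ≥ 1` and `n ≥ 0`; there `m` is a lower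
bound for the norm. -/
theorem IsHexPair.one_le {N : (Fin 2 → ℝ) → ℝ} (hN : IsPlaneNorm N) {p q : Fin 2 → ℝ}
    (h : IsHexPair N p q) (m n : ℤ) (hmn : m ≠ 0 ∨ n ≠ 0) : 1 ≤ N (m • p + n • q) := by
  refine sector_induction (T := fun m n : ℤ => ∀ p q, IsHexPair N p q → 1 ≤ N (m • p + n • q))
    ?_ ?_ m n hmn p q h
  · intro m n hm hn p q h
    have h1 := (h.coord_le hN (x := m) (y := n) (by exact_mod_cast hm.le)
      (by exact_mod_cast hn)).1
    simp only [Int.cast_smul_eq_zsmul] at h1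
    have : (1 : ℝ) ≤ m := by exact_mod_cast hm
    linarith
  · intro m n IH p q h
    rw [← combination_rotate]
    exact IH _ _ (h.rotate hN)

/-- If the norm is strict, the unit vectors of the lattice of a hexagon are its vertices. -/
theorem IsHexPair.eq_vertex {N : (Fin 2 → ℝ) → ℝ} (hN : IsPlaneNorm N) (hs : IsStrictNorm N)
    {p q : Fin 2 → ℝ} (h : IsHexPair N p q) (m n : ℤ) (h1 : N (m • p + n • q) = 1) :
    ∃ v, (v = p ∨ v = q ∨ v = q - p) ∧ (m • p + n • q = v ∨ m • p + n • q = -v) := by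
  have hmn : m ≠ 0 ∨ n ≠ 0 := by
    by_contra! h0
    rw [h0.1, h0.2] at h1
    simp [hN.zero] at h1
  refine sector_induction (T := fun m n : ℤ => ∀ p q, IsHexPair N p q → N (m • p + n • q) = 1 →
    ∃ v, (v = p ∨ v = q ∨ v = q - p) ∧ (m • p + n • q = v ∨ m • p + n • q = -v))
    ?_ ?_ m n hmn p q h h1
  · intro m n hm hn p q h h1
    have hc := h.coord_le hN (x := m) (y := n) (by exact_mod_cast hm.le) (by exact_mod_cast hn)
    simp only [Int.cast_smul_eq_zsmul, h1] at hc
    have hm1 : m = 1 := le_antisymm (by exact_mod_cast hc.1) hm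
    have hn1 : n ≤ 1 := by exact_mod_cast hc.2
    obtain rfl | rfl : n = 0 ∨ n = 1 := by omega
    · exact ⟨p, by simp, by simp [hm1]⟩
    -- The unit vector `q` would be the midpoint of the unit vectors `p + q` and `q - p`.
    · exfalso
      rw [hm1, one_smul, one_smul] at h1
      have hne : p + q ≠ q - p := by
        intro h0
        have h2 : p = 0 := by
          have : (2 : ℝ) • p = 0 := by
            have := sub_eq_zero.2 h0
            rw [← this]; module
          simpa using this
        have := h.left
        rw [h2, hN.zero] at this
        norm_num at this
      have h2 := hs _ _ h1 h.sub hne (1 / 2) (1 / 2) (by norm_num) (by norm_num) (by norm_num)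
      have h3 : (1 / 2 : ℝ) • (p + q) + (1 / 2 : ℝ) • (q - p) = q := by module
      rw [h3, h.right] at h2
      exact lt_irrefl _ h2
  · intro m n IH p q h h1
    rw [← combination_rotate] at h1 ⊢
    obtain ⟨v, hv, hv'⟩ := IH _ _ (h.rotate hN) h1
    rcases hv with rfl | rfl | rfl
    · exact ⟨v, by simp, hv'⟩
    · exact ⟨q - p, by simp, hv'⟩
    · refine ⟨p, by simp, ?_⟩
      rw [sub_sub_cancel_left, neg_neg] at hv'
      exact hv'.symm

/-- A lattice line through `b`, lower than the chord from `q - p` to `q`, meets the unit ball. -/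
theorem IsHexPair.exists_norm_lt_one {N : (Fin 2 → ℝ) → ℝ} (hN : IsPlaneNorm N)
    {p q b : Fin 2 → ℝ} (h : IsHexPair N p q) (h0 : 0 < planeDet p b)
    (hb : planeDet p b < planeDet p q) : ∃ k : ℤ, N (b + k • p) < 1 := by
  set t := planeDet p b / planeDet p q with ht
  set a := planeDet b q / planeDet p q
  have ht0 : 0 < t := div_pos h0 h.pos
  have ht1 : t < 1 := (div_lt_one h.pos).2 hb
  have hbe : b = a • p + t • q := eq_combination_of_planeDet_ne_zero h.ne_zero b
  -- At height `t` the hexagon extends over `s ∈ [-t, 1 - t]`, one full period of the lattice line;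
  -- the floor selects the representative in the half-open interval.
  refine ⟨-⌊a + t⌋, ?_⟩
  set s := Int.fract (a + t) - t with hsdef
  have hs1 : -t ≤ s := by have := Int.fract_nonneg (a + t); linarith
  have hs2 : s < 1 - t := by have := Int.fract_lt_one (a + t); linarith
  have e : b + (-⌊a + t⌋) • p = s • p + t • q := by
    rw [hsdef, Int.fract, ← Int.cast_smul_eq_zsmul ℝ]
    nth_rewrite 1 [hbe]
    push_cast
    module
  rw [e]
  rcases le_or_gt 0 s with h0 | h0
  · have := hN.combination_le h0 ht0.le p q
    rw [h.left, h.right] at this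
    linarith
  · have e2 : s • p + t • q = (-s) • (q - p) + (s + t) • q := by module
    have := hN.combination_le (s := -s) (t := s + t) (by linarith) (by linarith) (q - p) q
    rw [h.sub, h.right] at this
    rw [e2]
    linarith

/-- A lattice line through the chord from `q - p` to `q` meets the open unit ball or contains
`q`. -/
theorem IsHexPair.exists_norm_lt_one_or_eq {N : (Fin 2 → ℝ) → ℝ}
    (hs : IsStrictNorm N) {p q b : Fin 2 → ℝ} (h : IsHexPair N p q) (hp : p ≠ 0)
    (hb : planeDet p b = planeDet p q) : ∃ k : ℤ, N (b + k • p) < 1 ∨ b + k • p = q := by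
  set a := planeDet b q / planeDet p q
  have hbe : b = a • p + q := by
    have := eq_combination_of_planeDet_ne_zero h.ne_zero b
    rwa [hb, div_self h.ne_zero, one_smul] at this
  rcases (Int.fract_nonneg a).eq_or_lt with h0 | h0
  · refine ⟨-⌊a⌋, Or.inr ?_⟩
    have : a = ⌊a⌋ := by rw [Int.fract] at h0; linarith
    rw [← Int.cast_smul_eq_zsmul ℝ]
    push_cast
    rw [← this]
    nth_rewrite 1 [hbe]
    module
  -- The extra `-1` puts the point strictly between `q - p` and `q`.
  · refine ⟨-⌊a⌋ - 1, Or.inl ?_⟩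
    have e : b + (-⌊a⌋ - 1) • p = (1 - Int.fract a) • (q - p) + Int.fract a • q := by
      rw [Int.fract, ← Int.cast_smul_eq_zsmul ℝ]
      nth_rewrite 1 [hbe]
      push_cast
      module
    rw [e]
    refine hs _ _ h.sub h.right ?_ _ _ ?_ h0 (by ring)
    · intro h1
      exact hp (by simpa using h1)
    · linarith [Int.fract_lt_one a]

theorem IsHexPair.left_ne_zero {N : (Fin 2 → ℝ) → ℝ} {p q : Fin 2 → ℝ} (h : IsHexPair N p q) :
    p ≠ 0 := left_ne_zero_of_planeDet_ne_zero h.ne_zero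

/-- If `q'` were lower than `q`, its line parallel to `p` would contain a vector of norm below 1 in
the lattice of `(p, q')`. -/
theorem IsHexPair.planeDet_le {N : (Fin 2 → ℝ) → ℝ} (hN : IsPlaneNorm N) {p q q' : Fin 2 → ℝ}
    (h : IsHexPair N p q) (h' : IsHexPair N p q') : planeDet p q ≤ planeDet p q' := by
  by_contra! hlt
  obtain ⟨k, hk⟩ := h.exists_norm_lt_one hN h'.pos hlt
  have := h'.one_le hN k 1 (by simp)
  rw [one_smul, add_comm] at this
  linarith

/-- The points `q - p`, `q`, `q + c • p` are collinear in this order, and a strict unit sphere has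
no three collinear points. -/
theorem IsStrictNorm.add_smul_ne_one {N : (Fin 2 → ℝ) → ℝ} (hs : IsStrictNorm N)
    {p q : Fin 2 → ℝ} (hp : p ≠ 0) (h1 : N (q - p) = 1) (h2 : N q = 1) {c : ℝ} (hc : 0 < c) :
    N (q + c • p) ≠ 1 := by
  intro h3
  have hc1 : 0 < c + 1 := by positivity
  have e : (c / (c + 1)) • (q - p) + (1 / (c + 1)) • (q + c • p) = q := by
    match_scalars <;> field_simp
    ring
  have := hs _ _ h1 h3 ?_ (c / (c + 1)) (1 / (c + 1)) (by positivity) (by positivity)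
    (by field_simp)
  · rw [e, h2] at this
    exact lt_irrefl _ this
  · intro h0
    have h1 : (c + 1) • p = 0 := by
      have := sub_eq_zero.2 h0.symm
      rw [← this]; module
    rcases smul_eq_zero.1 h1 with h1 | h1
    · exact hc1.ne' h1
    · exact hp h1

/-- Equal determinants put `q` and `q'` on one parallel to `p`, so they differ by an integer
multiple of `p`; strictness makes the multiple zero. -/
theorem IsHexPair.unique {N : (Fin 2 → ℝ) → ℝ} (hN : IsPlaneNorm N) (hs : IsStrictNorm N)
    {p q q' : Fin 2 → ℝ} (h : IsHexPair N p q) (h' : IsHexPair N p q') : q = q' := by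
  obtain ⟨k, hk | hk⟩ := h'.exists_norm_lt_one_or_eq hs h.left_ne_zero
    (le_antisymm (h.planeDet_le hN h') (h'.planeDet_le hN h))
  · have := h.one_le hN k 1 (by simp)
    rw [one_smul, add_comm] at this
    linarith
  have hmid : ∀ {q q' : Fin 2 → ℝ} (k : ℤ), IsHexPair N p q → IsHexPair N p q' →
      q + k • p = q' → k ≤ 0 := by
    intro q q' k h h' hk
    by_contra! hpos
    rw [← Int.cast_smul_eq_zsmul ℝ] at hk
    refine hs.add_smul_ne_one h.left_ne_zero h.sub h.right (c := k) (by exact_mod_cast hpos) ?_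
    rw [hk, h'.right]
  have h1 := hmid k h h' hk
  have h2 := hmid (-k) h' h (by rw [← hk]; module)
  have : k = 0 := by omega
  simpa [this] using hk

/-- Intermediate value theorem: along half the unit sphere from `p` to `-p`, the distance to `p`
grows from 0 to 2, hence takes the value 1. -/
theorem exists_isHexPair {N : (Fin 2 → ℝ) → ℝ} (hN : IsPlaneNorm N) {p : Fin 2 → ℝ}
    (hp : N p = 1) : ∃ q, IsHexPair N p q := by
  have hp0 : p ≠ 0 := by
    rintro rfl
    rw [hN.zero] at hp
    norm_num at hp
  set w : Fin 2 → ℝ := ![-p 1, p 0] with hw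
  have hpw : 0 < planeDet p w := by
    have : planeDet p w = p 0 ^ 2 + p 1 ^ 2 := by simp [planeDet, hw]; ring
    rw [this]
    by_contra! h
    apply hp0
    ext i
    fin_cases i <;> simp <;> nlinarith [sq_nonneg (p 0), sq_nonneg (p 1)]
  set c : ℝ → Fin 2 → ℝ := fun t => Real.cos t • p + Real.sin t • w
  have hc0 : ∀ t, c t ≠ 0 := by
    intro t
    apply combination_ne_zero hpw.ne'
    by_contra! h
    have := Real.sin_sq_add_cos_sq t
    rw [h.1, h.2] at this
    norm_num at this
  have hcc : Continuous c := by fun_prop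
  set g : ℝ → Fin 2 → ℝ := fun t => (N (c t))⁻¹ • c t
  have hNc : ∀ t, 0 < N (c t) := fun t => hN.pos _ (hc0 t)
  have hgc : Continuous g :=
    ((hN.continuous.comp hcc).inv₀ fun t => (hNc t).ne').smul hcc
  have hg1 : ∀ t, N (g t) = 1 := fun t => by
    rw [hN.smul_of_nonneg (inv_nonneg.2 (hNc t).le), inv_mul_cancel₀ (hNc t).ne']
  have hg0 : g 0 = p := by simp [g, c, hp]
  have hgpi : g Real.pi = -p := by simp [g, c, hN.neg, hp]
  have hcont : ContinuousOn (fun t => N (g t - p)) (Set.Icc 0 Real.pi) :=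
    (hN.continuous.comp (hgc.sub continuous_const)).continuousOn
  have hmem : (1 : ℝ) ∈ Set.Icc (N (g 0 - p)) (N (g Real.pi - p)) := by
    rw [hg0, hgpi, sub_self, hN.zero]
    have : -p - p = (-2 : ℝ) • p := by module
    rw [this, hN.smul, hp]
    norm_num
  obtain ⟨t, ht, ht1⟩ := intermediate_value_Icc Real.pi_pos.le hcont hmem
  refine ⟨g t, hp, hg1 t, ht1, ?_⟩
  have ht0 : t ≠ 0 := by
    rintro rfl
    simp [hg0, hN.zero] at ht1
  have htpi : t ≠ Real.pi := by
    rintro rfl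
    have : -p - p = (-2 : ℝ) • p := by module
    simp only [hgpi] at ht1
    rw [this, hN.smul, hp] at ht1
    norm_num at ht1
  have hsin : 0 < Real.sin t :=
    Real.sin_pos_of_pos_of_lt_pi (lt_of_le_of_ne ht.1 ht0.symm) (lt_of_le_of_ne ht.2 htpi)
  have : planeDet p (g t) = (N (c t))⁻¹ * (Real.sin t * planeDet p w) := by
    rw [planeDet_smul_right, planeDet_add_right, planeDet_smul_right, planeDet_smul_right,
      planeDet_self]
    ring
  rw [this]
  have := hNc t
  positivity

/-- The unit vectors on `ℝp` are `±p`, at distance 0 or 2 from `p`. This keeps the strict inequality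
of `IsHexPair` under limits. -/
theorem IsPlaneNorm.planeDet_ne_zero {N : (Fin 2 → ℝ) → ℝ} (hN : IsPlaneNorm N)
    {p q : Fin 2 → ℝ} (hp : N p = 1) (hq : N q = 1) (hpq : N (q - p) = 1) :
    planeDet p q ≠ 0 := by
  intro h0
  obtain ⟨w, hw⟩ := exists_isHexPair hN hp
  have h1 := eq_combination_of_planeDet_ne_zero hw.ne_zero q
  rw [h0, zero_div, zero_smul, add_zero] at h1
  set a := planeDet q w / planeDet p w
  have h2 : q - p = (a - 1) • p := by rw [h1]; module
  rw [h2, hN.smul, hp, mul_one] at hpq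
  rw [h1, hN.smul, hp, mul_one] at hq
  rcases eq_or_eq_neg_of_abs_eq hq with h | h <;> rw [h] at hpq <;> norm_num at hpq

/-! ### Gauges of symmetric convex domains. -/

theorem IsSymmetricConvexDomain.zero_mem {K : Set (Fin 2 → ℝ)} (hK : IsSymmetricConvexDomain K) :
    0 ∈ K := by
  obtain ⟨x, hx⟩ := hK.nonempty
  have := hK.convex hx (hK.neg_mem x hx) (a := 1 / 2) (b := 1 / 2) (by norm_num) (by norm_num)
    (by norm_num)
  simpa using this

theorem IsSymmetricConvexDomain.mem_nhds_zero {K : Set (Fin 2 → ℝ)}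
    (hK : IsSymmetricConvexDomain K) : K ∈ nhds 0 := hK.isOpen.mem_nhds hK.zero_mem

theorem IsSymmetricConvexDomain.isPlaneNorm {K : Set (Fin 2 → ℝ)}
    (hK : IsSymmetricConvexDomain K) : IsPlaneNorm (gauge K) where
  continuous := continuous_gauge hK.convex hK.mem_nhds_zero
  add_le := gauge_add_le hK.convex (absorbent_nhds_zero hK.mem_nhds_zero)
  smul c x := by
    have hneg : ∀ y, gauge K (-y) = gauge K y := gauge_neg hK.neg_mem
    rcases le_total 0 c with hc | hc
    · rw [gauge_smul_of_nonneg hc, abs_of_nonneg hc, smul_eq_mul]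
    · rw [← hneg, ← neg_smul, gauge_smul_of_nonneg (neg_nonneg.2 hc), abs_of_nonpos hc,
        smul_eq_mul]
  pos x hx := (gauge_pos (absorbent_nhds_zero hK.mem_nhds_zero)
    ((NormedSpace.isVonNBounded_iff ℝ).2 hK.isBounded)).2 hx

theorem IsSymmetricConvexDomain.gauge_lt_one {K : Set (Fin 2 → ℝ)}
    (hK : IsSymmetricConvexDomain K) {x : Fin 2 → ℝ} : gauge K x < 1 ↔ x ∈ K := by
  rw [gauge_lt_one_iff_mem_interior hK.convex hK.mem_nhds_zero, hK.isOpen.interior_eq]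

theorem IsSymmetricConvexDomain.gauge_eq_one {K : Set (Fin 2 → ℝ)}
    (hK : IsSymmetricConvexDomain K) {x : Fin 2 → ℝ} : gauge K x = 1 ↔ x ∈ frontier K :=
  gauge_eq_one_iff_mem_frontier hK.convex hK.mem_nhds_zero

theorem IsSymmetricConvexDomain.gauge_le_of_subset {H K : Set (Fin 2 → ℝ)}
    (hH : IsSymmetricConvexDomain H) (hHK : H ⊆ K) (x : Fin 2 → ℝ) : gauge K x ≤ gauge H x :=
  gauge_mono (absorbent_nhds_zero hH.mem_nhds_zero) hHK x

theorem IsSymmetricConvexDomain.isStrictNorm {K : Set (Fin 2 → ℝ)}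
    (hK : IsSymmetricConvexDomain K) (hs : HasStrictlyConvexBoundary K) :
    IsStrictNorm (gauge K) := by
  intro x y hx hy hxy s t hs0 ht0 hst
  have hle := hK.isPlaneNorm.combination_le hs0.le ht0.le x y
  rw [hx, hy, mul_one, mul_one, hst] at hle
  refine lt_of_le_of_ne hle fun h1 => ?_
  have hs' : s = 1 - t := by linarith
  have hz : s • x + t • y ∈ line[ℝ, x, y] := by
    have := AffineMap.lineMap_mem_affineSpan_pair t x y
    rwa [AffineMap.lineMap_apply_module, ← hs'] at this
  rcases hs x (hK.gauge_eq_one.1 hx) y (hK.gauge_eq_one.1 hy) hxy _ hz (hK.gauge_eq_one.1 h1)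
    with h | h
  · have : t • (y - x) = 0 := by
      have := sub_eq_zero.2 h
      rw [← this, hs']; module
    rcases smul_eq_zero.1 this with h | h
    · exact ht0.ne' h
    · exact hxy (sub_eq_zero.1 h).symm
  · have : s • (x - y) = 0 := by
      have := sub_eq_zero.2 h
      rw [← this, eq_sub_of_add_eq' hst]; module
    rcases smul_eq_zero.1 this with h | h
    · exact hs0.ne' h
    · exact hxy (sub_eq_zero.1 h)

/-! ### Lattices given by bases. -/

/-- The matrix with columns `p` and `q`, for a basis `(p, q)` of the plane. -/
noncomputable def basisMatrix (x : {x : (Fin 2 → ℝ) × (Fin 2 → ℝ) // planeDet x.1 x.2 ≠ 0}) :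
    GL (Fin 2) ℝ :=
  Matrix.GeneralLinearGroup.mkOfDetNeZero
    !![x.1.1 0, x.1.2 0; x.1.1 1, x.1.2 1] (by
      have := x.2
      rw [Matrix.det_fin_two_of]
      unfold planeDet at this
      rwa [mul_comm (x.1.2 0)])

theorem continuous_basisMatrix : Continuous basisMatrix := by
  have h0 : Continuous fun x : {x : (Fin 2 → ℝ) × (Fin 2 → ℝ) // planeDet x.1 x.2 ≠ 0} =>
      (!![x.1.1 0, x.1.2 0; x.1.1 1, x.1.2 1] : Matrix (Fin 2) (Fin 2) ℝ) := by
    refine continuous_matrix fun i j => ?_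
    fin_cases i <;> fin_cases j <;> simp <;> fun_prop
  refine Units.continuous_iff.2 ⟨h0, ?_⟩
  have h1 : (Units.val ∘ fun x => (basisMatrix x)⁻¹) =
      fun x : {x : (Fin 2 → ℝ) × (Fin 2 → ℝ) // planeDet x.1 x.2 ≠ 0} =>
        (planeDet x.1.1 x.1.2)⁻¹ •
          (!![x.1.1 0, x.1.2 0; x.1.1 1, x.1.2 1] : Matrix (Fin 2) (Fin 2) ℝ).adjugate := by
    ext1 x
    simp only [Function.comp_apply]
    rw [Matrix.coe_units_inv, Matrix.inv_def, Ring.inverse_eq_inv']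
    change (Matrix.det !![x.1.1 0, x.1.2 0; x.1.1 1, x.1.2 1])⁻¹ • _ = _
    rw [Matrix.det_fin_two_of, mul_comm (x.1.2 0)]
    rfl
  have h2 : Continuous fun x : {x : (Fin 2 → ℝ) × (Fin 2 → ℝ) // planeDet x.1 x.2 ≠ 0} =>
      planeDet x.1.1 x.1.2 :=
    (continuous_fst.comp continuous_subtype_val).planeDet
      (continuous_snd.comp continuous_subtype_val)
  rw [show (fun x => ((basisMatrix x)⁻¹).val) = _ from h1]
  exact (h2.inv₀ fun x => x.2).smul h0.matrix_adjugate

/-- The lattice with basis `(p, q)`. -/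
noncomputable def latticeOfBasis
    (x : {x : (Fin 2 → ℝ) × (Fin 2 → ℝ) // planeDet x.1 x.2 ≠ 0}) : LatticeSpace :=
  (basisMatrix x : LatticeSpace)

theorem continuous_latticeOfBasis : Continuous latticeOfBasis :=
  continuous_quotient_mk'.comp continuous_basisMatrix

theorem mem_latticePoints_latticeOfBasis {p q : Fin 2 → ℝ} (h : planeDet p q ≠ 0)
    {x : Fin 2 → ℝ} :
    x ∈ latticePoints (latticeOfBasis ⟨(p, q), h⟩) ↔ ∃ m n : ℤ, x = m • p + n • q := by
  have e : ∀ n : Fin 2 → ℤ, (basisMatrix ⟨(p, q), h⟩ : Matrix (Fin 2) (Fin 2) ℝ) *ᵥ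
      (fun i => (n i : ℝ)) = n 0 • p + n 1 • q := by
    intro n
    change !![p 0, q 0; p 1, q 1] *ᵥ _ = _
    ext i
    fin_cases i <;> simp [Matrix.mulVec, dotProduct, Fin.sum_univ_two] <;> ring
  change x ∈ Set.range _ ↔ _
  simp only [e, Set.mem_range]
  constructor
  · rintro ⟨n, rfl⟩
    exact ⟨_, _, rfl⟩
  · rintro ⟨m, n, rfl⟩
    exact ⟨![m, n], by simp⟩

theorem latticeCovolume_latticeOfBasis {p q : Fin 2 → ℝ} (h : planeDet p q ≠ 0) :
    latticeCovolume (latticeOfBasis ⟨(p, q), h⟩) = |planeDet p q| := by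
  change |Matrix.det !![p 0, q 0; p 1, q 1]| = _
  rw [Matrix.det_fin_two_of, mul_comm (q 0)]
  rfl

theorem latticeCovolume_nonneg (Λ : LatticeSpace) : 0 ≤ latticeCovolume Λ := by
  induction Λ using Quotient.inductionOn
  exact abs_nonneg _

/-- A pair of lattice points whose determinant is the covolume is a basis. -/
theorem eq_latticeOfBasis {Λ : LatticeSpace} {p q : Fin 2 → ℝ} (h : planeDet p q ≠ 0)
    (hp : p ∈ latticePoints Λ) (hq : q ∈ latticePoints Λ)
    (hd : latticeCovolume Λ = |planeDet p q|) : Λ = latticeOfBasis ⟨(p, q), h⟩ := by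
  induction Λ using Quotient.inductionOn with | _ g
  obtain ⟨m, hm⟩ := hp
  obtain ⟨n, hn⟩ := hq
  set M : Matrix (Fin 2) (Fin 2) ℤ := !![m 0, n 0; m 1, n 1] with hM
  have e : (basisMatrix ⟨(p, q), h⟩ : Matrix (Fin 2) (Fin 2) ℝ) =
      g * M.map (Int.castRingHom ℝ) := by
    change !![p 0, q 0; p 1, q 1] = _
    ext i j
    fin_cases j
    · rw [Matrix.mul_apply]
      fin_cases i <;> simp [← hm, hM, Fin.sum_univ_two]
    · rw [Matrix.mul_apply]
      fin_cases i <;> simp [← hn, hM, Fin.sum_univ_two]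
  have hdet : planeDet p q = (g : Matrix (Fin 2) (Fin 2) ℝ).det * M.det := by
    have := congrArg Matrix.det e
    rw [Matrix.det_mul] at this
    change Matrix.det !![p 0, q 0; p 1, q 1] = _ at this
    rw [Matrix.det_fin_two_of, mul_comm (q 0)] at this
    change planeDet p q = _ at this
    rw [this]
    congr 1
    exact ((Int.castRingHom ℝ).map_det M).symm
  have hd' : |(g : Matrix (Fin 2) (Fin 2) ℝ).det| = |planeDet p q| := hd
  -- Equality of covolumes forces the integral change of basis to have determinant ±1.
  have hu : IsUnit M := by
    rw [Matrix.isUnit_iff_isUnit_det, Int.isUnit_iff_abs_eq]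
    rw [hdet, abs_mul] at hd'
    have hg : |(g : Matrix (Fin 2) (Fin 2) ℝ).det| ≠ 0 := by
      rw [abs_ne_zero]
      rintro h0
      exact h (by rw [hdet, h0, zero_mul])
    have h1 : |(M.det : ℝ)| = 1 := by
      apply mul_left_cancel₀ hg
      rw [← hd', mul_one]
    exact_mod_cast h1
  obtain ⟨u, hu⟩ := hu
  refine QuotientGroup.eq.2 ⟨u, ?_⟩
  rw [eq_inv_mul_iff_mul_eq]
  ext1
  rw [Units.val_mul, e, ← hu]
  rfl

theorem zero_mem_latticePoints (Λ : LatticeSpace) : 0 ∈ latticePoints Λ := by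
  induction Λ using Quotient.inductionOn
  exact ⟨0, by ext i; simp [Matrix.mulVec, dotProduct]⟩

theorem latticePoints_combination {Λ : LatticeSpace} {x y : Fin 2 → ℝ}
    (hx : x ∈ latticePoints Λ) (hy : y ∈ latticePoints Λ) (m n : ℤ) :
    m • x + n • y ∈ latticePoints Λ := by
  induction Λ using Quotient.inductionOn with | _ g
  obtain ⟨a, rfl⟩ := hx
  obtain ⟨b, rfl⟩ := hy
  refine ⟨m • a + n • b, ?_⟩
  simp only [← Matrix.mulVec_smul, ← Matrix.mulVec_add]
  congr 1
  ext i
  simp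

/-! ### Admissible lattices, shortest vectors and critical lattices. -/

theorem IsSymmetricConvexDomain.isAdmissible_iff {K : Set (Fin 2 → ℝ)}
    (hK : IsSymmetricConvexDomain K) {Λ : LatticeSpace} :
    IsAdmissible K Λ ↔ ∀ x ∈ latticePoints Λ, x ≠ 0 → 1 ≤ gauge K x := by
  constructor
  · intro h x hx hx0
    by_contra! hlt
    have : x ∈ latticePoints Λ ∩ K := ⟨hx, hK.gauge_lt_one.1 hlt⟩
    rw [h] at this
    exact hx0 this
  · intro h
    refine Set.Subset.antisymm ?_ ?_
    · rintro x ⟨hx, hxK⟩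
      by_contra hx0
      exact (h x hx hx0).not_gt (hK.gauge_lt_one.2 hxK)
    · rintro _ rfl
      exact ⟨zero_mem_latticePoints Λ, hK.zero_mem⟩

theorem IsPlaneNorm.exists_pos_mul_norm_le {N : (Fin 2 → ℝ) → ℝ} (hN : IsPlaneNorm N) :
    ∃ c > 0, ∀ x, c * ‖x‖ ≤ N x := by
  obtain ⟨z, hz, hmin⟩ := (isCompact_sphere (0 : Fin 2 → ℝ) 1).exists_isMinOn
    (NormedSpace.sphere_nonempty.2 zero_le_one) hN.continuous.continuousOn
  have hz0 : z ≠ 0 := by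
    rintro rfl
    simp at hz
  refine ⟨N z, hN.pos z hz0, fun x => ?_⟩
  rcases eq_or_ne x 0 with rfl | hx
  · simp [hN.zero]
  · have hx' : 0 < ‖x‖ := norm_pos_iff.2 hx
    have h1 : N z ≤ N (‖x‖⁻¹ • x) := hmin (by simp [norm_smul, hx'.ne'])
    rw [hN.smul_of_nonneg (by positivity)] at h1
    calc N z * ‖x‖ ≤ ‖x‖⁻¹ * N x * ‖x‖ := by gcongr
      _ = N x := by field_simp

/-- A shortest nonzero vector of a lattice is part of a basis. -/
theorem exists_shortest_vector {N : (Fin 2 → ℝ) → ℝ} (hN : IsPlaneNorm N) (Λ : LatticeSpace) :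
    ∃ v ∈ latticePoints Λ, v ≠ 0 ∧ (∀ x ∈ latticePoints Λ, x ≠ 0 → N v ≤ N x) ∧
      ∃ b ∈ latticePoints Λ, planeDet v b = latticeCovolume Λ ∧ 0 < planeDet v b := by
  induction Λ using Quotient.inductionOn with | _ g
  set G : Matrix (Fin 2) (Fin 2) ℝ := g.val
  have hdet : G.det ≠ 0 := (Matrix.GeneralLinearGroup.det g).ne_zero
  have hinj : Function.Injective G.mulVec := Matrix.mulVec_injective_of_isUnit g.isUnit
  have hG0 : ∀ x, x ≠ 0 → G *ᵥ x ≠ 0 := by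
    intro x hx h0
    exact hx (hinj (by rw [h0, Matrix.mulVec_zero]))
  have hM : IsPlaneNorm fun x => N (G *ᵥ x) :=
    { continuous := hN.continuous.comp (continuous_const.matrix_mulVec continuous_id)
      add_le := fun x y => by rw [Matrix.mulVec_add]; exact hN.add_le _ _
      smul := fun c x => by rw [Matrix.mulVec_smul]; exact hN.smul _ _
      pos := fun x hx => hN.pos _ (hG0 x hx) }
  set ι : (Fin 2 → ℤ) → Fin 2 → ℝ := fun n i => (n i : ℝ) with hι
  have hι0 : ∀ n, n ≠ 0 → ι n ≠ 0 := by
    intro n hn h0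
    apply hn
    ext i
    have : (n i : ℝ) = 0 := congrFun h0 i
    exact_mod_cast this
  obtain ⟨c, hc, hcM⟩ := hM.exists_pos_mul_norm_le
  have hnorm : ∀ n, ‖ι n‖ = ‖n‖ := by
    intro n
    rw [Pi.norm_def, Pi.norm_def]
    congr 2
  obtain ⟨n, hn0, hmin⟩ : ∃ n : Fin 2 → ℤ, n ≠ 0 ∧ ∀ m, m ≠ 0 → N (G *ᵥ ι n) ≤ N (G *ᵥ ι m) := by
    -- The norm of some nonzero lattice vector serves as cutoff; only finitely many lattice vectors
    -- lie below it.
    set R := N (G *ᵥ ι 1)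
    set S : Set (Fin 2 → ℤ) := {m | m ≠ 0 ∧ N (G *ᵥ ι m) ≤ R} with hS
    have hfin : S.Finite := by
      refine ((isCompact_closedBall (0 : Fin 2 → ℤ) (R / c)).finite_of_discrete).subset ?_
      rintro m ⟨-, hm⟩
      rw [mem_closedBall_zero_iff, ← hnorm, le_div_iff₀ hc, mul_comm]
      exact (hcM _).trans hm
    obtain ⟨n, hn, hmin⟩ := Set.exists_min_image S (fun m => N (G *ᵥ ι m)) hfin
      ⟨1, one_ne_zero, le_rfl⟩
    refine ⟨n, hn.1, fun m hm => ?_⟩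
    rcases le_or_gt (N (G *ᵥ ι m)) R with h | h
    · exact hmin m ⟨hm, h⟩
    · exact hn.2.trans h.le
  -- A shortest vector is primitive, since dividing by the gcd would shorten it; Bézout then
  -- completes it to a basis.
  have hgcd : Int.gcd (n 0) (n 1) = 1 := by
    obtain ⟨a, ha⟩ := Int.gcd_dvd_left (n 0) (n 1)
    obtain ⟨b, hb⟩ := Int.gcd_dvd_right (n 0) (n 1)
    set k := Int.gcd (n 0) (n 1)
    have e : n = (k : ℤ) • ![a, b] := by
      ext i
      fin_cases i <;> simp [← ha, ← hb]
    have h0 : (![a, b] : Fin 2 → ℤ) ≠ 0 := by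
      intro h0
      rw [h0, smul_zero] at e
      exact hn0 e
    have e2 : ι n = (k : ℝ) • ι ![a, b] := by
      rw [e]
      ext i
      simp only [hι, Pi.smul_apply, smul_eq_mul]
      push_cast
      rfl
    have h1 := hmin _ h0
    have h2 := hN.pos _ (hG0 _ (hι0 _ h0))
    rw [e2, Matrix.mulVec_smul, hN.smul_of_nonneg (Nat.cast_nonneg k)] at h1
    have h3 : (k : ℝ) ≤ 1 := by
      by_contra! h
      nlinarith
    have h4 : k ≠ 0 := by
      intro hk
      rw [hk] at e
      apply hn0
      rw [e]
      simp
    have : k ≤ 1 := by exact_mod_cast h3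
    omega
  have hdetmul : ∀ x y : Fin 2 → ℝ, planeDet (G *ᵥ x) (G *ᵥ y) = G.det * planeDet x y := by
    intro x y
    simp [planeDet, Matrix.mulVec, dotProduct, Fin.sum_univ_two, Matrix.det_fin_two]
    ring
  obtain ⟨m, hm⟩ : ∃ m : Fin 2 → ℤ, planeDet (ι n) (ι m) = 1 := by
    have hb := Int.gcd_eq_gcd_ab (n 0) (n 1)
    rw [hgcd] at hb
    refine ⟨![-Int.gcdB (n 0) (n 1), Int.gcdA (n 0) (n 1)], ?_⟩
    simp only [planeDet, hι, Matrix.cons_val_zero, Matrix.cons_val_one]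
    have : (1 : ℤ) = n 0 * Int.gcdA (n 0) (n 1) - n 1 * -Int.gcdB (n 0) (n 1) := by
      rw [← Nat.cast_one, hb]; ring
    exact_mod_cast this.symm
  refine ⟨G *ᵥ ι n, ⟨n, rfl⟩, hG0 _ (hι0 n hn0), ?_, ?_⟩
  · rintro _ ⟨m, rfl⟩ hm0
    apply hmin
    rintro rfl
    apply hm0
    ext i
    simp [Matrix.mulVec, dotProduct]
  · change ∃ b ∈ _, _ = |G.det| ∧ _
    rcases lt_or_gt_of_ne hdet with hd | hd
    · refine ⟨G *ᵥ ι (-m), ⟨-m, rfl⟩, ?_⟩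
      have e : ι (-m) = -ι m := by ext i; simp [hι]
      rw [e, hdetmul, planeDet_neg_right, hm, abs_of_neg hd]
      constructor <;> linarith
    · refine ⟨G *ᵥ ι m, ⟨m, rfl⟩, ?_⟩
      rw [hdetmul, hm, abs_of_pos hd]
      constructor <;> linarith

/-- A hexagon inscribed in `K` generates a `K`-admissible lattice. -/
theorem IsHexPair.isAdmissible {K : Set (Fin 2 → ℝ)} (hK : IsSymmetricConvexDomain K)
    {p q : Fin 2 → ℝ} (h : IsHexPair (gauge K) p q) :
    IsAdmissible K (latticeOfBasis ⟨(p, q), h.ne_zero⟩) := by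
  refine hK.isAdmissible_iff.2 fun x hx hx0 => ?_
  obtain ⟨m, n, rfl⟩ := (mem_latticePoints_latticeOfBasis _).1 hx
  refine h.one_le hK.isPlaneNorm m n ?_
  by_contra! h0
  exact hx0 (by simp [h0.1, h0.2])

theorem criticalDeterminant_le {K : Set (Fin 2 → ℝ)} {Λ : LatticeSpace} (h : IsAdmissible K Λ) :
    criticalDeterminant K ≤ latticeCovolume Λ :=
  csInf_le ⟨0, by rintro _ ⟨Λ, -, rfl⟩; exact latticeCovolume_nonneg Λ⟩ ⟨Λ, h, rfl⟩

theorem IsHexPair.criticalDeterminant_le {K : Set (Fin 2 → ℝ)} (hK : IsSymmetricConvexDomain K)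
    {p q : Fin 2 → ℝ} (h : IsHexPair (gauge K) p q) : criticalDeterminant K ≤ planeDet p q := by
  have := _root_.criticalDeterminant_le (h.isAdmissible hK)
  rwa [latticeCovolume_latticeOfBasis, abs_of_pos h.pos] at this

/-- Every admissible lattice dominates an inscribed hexagon. -/
theorem IsAdmissible.exists_isHexPair {K : Set (Fin 2 → ℝ)} (hK : IsSymmetricConvexDomain K)
    {Λ : LatticeSpace} (h : IsAdmissible K Λ) :
    ∃ p q, IsHexPair (gauge K) p q ∧ ∃ r : ℝ, 1 ≤ r ∧ r • p ∈ latticePoints Λ ∧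
      r ^ 2 * planeDet p q ≤ latticeCovolume Λ ∧
      ∃ b ∈ latticePoints Λ, planeDet (r • p) b = latticeCovolume Λ := by
  have hN := hK.isPlaneNorm
  obtain ⟨v, hv, hv0, hmin, b, hb, hbd, hbpos⟩ := exists_shortest_vector hN Λ
  set r := gauge K v
  have hr : 1 ≤ r := hK.isAdmissible_iff.1 h v hv hv0
  have hr0 : 0 < r := by linarith
  have hp : gauge K (r⁻¹ • v) = 1 := by
    rw [hN.smul_of_nonneg (inv_nonneg.2 hr0.le)]
    exact inv_mul_cancel₀ hr0.ne'
  have hrv : r • r⁻¹ • v = v := smul_inv_smul₀ hr0.ne' v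
  obtain ⟨q, hq⟩ := _root_.exists_isHexPair hN hp
  refine ⟨r⁻¹ • v, q, hq, r, hr, by rwa [hrv], ?_, b, hb, by rw [hrv, hbd]⟩
  -- Otherwise, after scaling by `r⁻¹`, the lattice line through `b` runs below the chord of the
  -- hexagon and contains a vector shorter than `v`.
  by_contra! hlt
  have e : planeDet (r⁻¹ • v) (r⁻¹ • b) = (r ^ 2)⁻¹ * planeDet v b := by
    rw [planeDet_smul_left, planeDet_smul_right]
    field_simp
  obtain ⟨k, hk⟩ := hq.exists_norm_lt_one hN (b := r⁻¹ • b) (by rw [e]; positivity) (by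
    rw [e, hbd, inv_mul_lt_iff₀ (by positivity)]
    exact hlt)
  have e2 : r⁻¹ • b + k • r⁻¹ • v = r⁻¹ • (b + k • v) := by
    rw [smul_add, smul_comm]
  rw [e2, hN.smul_of_nonneg (inv_nonneg.2 hr0.le), inv_mul_lt_iff₀ hr0, mul_one] at hk
  have hmem : b + k • v ∈ latticePoints Λ := by
    simpa using latticePoints_combination hb hv 1 k
  refine hk.not_ge (hmin _ hmem fun h0 => ?_)
  have := planeDet_add_right v b (k • v)
  rw [h0, ← Int.cast_smul_eq_zsmul ℝ, planeDet_smul_right, planeDet_self] at this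
  simp [planeDet] at this hbpos
  linarith

theorem IsAdmissible.exists_isHexPair_planeDet_le {K : Set (Fin 2 → ℝ)}
    (hK : IsSymmetricConvexDomain K)
    {Λ : LatticeSpace} (h : IsAdmissible K Λ) : ∃ p q, IsHexPair (gauge K) p q ∧
      planeDet p q ≤ latticeCovolume Λ := by
  obtain ⟨p, q, hpq, r, hr, -, hle, -⟩ := h.exists_isHexPair hK
  refine ⟨p, q, hpq, le_trans ?_ hle⟩
  exact le_mul_of_one_le_left hpq.pos.le (one_le_pow₀ hr)

/-- For strictly convex `K`, critical lattices are generated by inscribed hexagons. -/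
theorem exists_eq_latticeOfBasis {K : Set (Fin 2 → ℝ)} (hK : IsSymmetricConvexDomain K)
    (hs : HasStrictlyConvexBoundary K) {Λ : LatticeSpace} (h : Λ ∈ criticalLocus K) :
    ∃ p q, ∃ hpq : IsHexPair (gauge K) p q, Λ = latticeOfBasis ⟨(p, q), hpq.ne_zero⟩ := by
  obtain ⟨p, q, hpq, r, hr, hrp, hle, b, hb, hbd⟩ := h.1.exists_isHexPair hK
  have h1 := hpq.criticalDeterminant_le hK
  rw [← h.2] at h1
  have hr1 : r = 1 := by
    have := hpq.pos
    by_contra hne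
    have hr' : 1 < r := lt_of_le_of_ne hr (Ne.symm hne)
    have := one_lt_pow₀ hr' two_ne_zero
    nlinarith
  subst hr1
  rw [one_smul] at hrp hbd
  have hcov : latticeCovolume Λ = planeDet p q := le_antisymm h1 (by simpa using hle)
  obtain ⟨k, hk⟩ := hpq.exists_norm_lt_one_or_eq (hK.isStrictNorm hs) hpq.left_ne_zero
    (hbd.trans hcov)
  have hmem : b + k • p ∈ latticePoints Λ := by
    simpa using latticePoints_combination hb hrp 1 k
  rcases hk with hk | hk
  · refine absurd (hK.isAdmissible_iff.1 h.1 _ hmem fun h0 => ?_) hk.not_ge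
    have := planeDet_add_right p b (k • p)
    rw [h0, ← Int.cast_smul_eq_zsmul ℝ, planeDet_smul_right, planeDet_self, hbd, hcov] at this
    have h2 := hpq.pos
    simp [planeDet] at this h2
    linarith
  · rw [hk] at hmem
    exact ⟨p, q, hpq, eq_latticeOfBasis _ hrp hmem (by rw [hcov, abs_of_pos hpq.pos])⟩

/-! ### The space of lattices is Hausdorff. -/

/-- Integrality of entries is a closed condition, imposed on the matrix and on its inverse. A closed
subgroup has a Hausdorff quotient, which later turns a continuous injection of the circle into an
embedding. -/
theorem isClosed_integralGL2 : IsClosed (integralGL2 : Set (GL (Fin 2) ℝ)) := by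
  have hZ : IsClosed {A : Matrix (Fin 2) (Fin 2) ℝ | ∀ i j, A i j ∈ Set.range ((↑) : ℤ → ℝ)} := by
    simp only [Set.ofPred_forall]
    exact isClosed_iInter fun i => isClosed_iInter fun j =>
      Int.isClosedEmbedding_coe_real.isClosed_range.preimage
        ((continuous_apply j).comp (continuous_apply i))
  have e : (integralGL2 : Set (GL (Fin 2) ℝ)) =
      (fun g : GL (Fin 2) ℝ => (g : Matrix (Fin 2) (Fin 2) ℝ)) ⁻¹'
        {A | ∀ i j, A i j ∈ Set.range ((↑) : ℤ → ℝ)} ∩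
      (fun g : GL (Fin 2) ℝ => ((g⁻¹ : GL (Fin 2) ℝ) : Matrix (Fin 2) (Fin 2) ℝ)) ⁻¹'
        {A | ∀ i j, A i j ∈ Set.range ((↑) : ℤ → ℝ)} := by
    ext g
    constructor
    · rintro ⟨u, rfl⟩
      refine ⟨fun i j => ⟨(u : Matrix (Fin 2) (Fin 2) ℤ) i j, rfl⟩, fun i j => ?_⟩
      exact ⟨((u⁻¹ : GL (Fin 2) ℤ) : Matrix (Fin 2) (Fin 2) ℤ) i j, rfl⟩
    · rintro ⟨h1, h2⟩
      choose A hA using h1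
      choose B hB using h2
      have hA' : (Matrix.of A).map (Int.castRingHom ℝ) = g := by ext i j; exact hA i j
      have hB' : (Matrix.of B).map (Int.castRingHom ℝ) = (g⁻¹ : GL (Fin 2) ℝ) := by
        ext i j; exact hB i j
      have hinj : Function.Injective fun M : Matrix (Fin 2) (Fin 2) ℤ =>
          M.map (Int.castRingHom ℝ) := Matrix.map_injective Int.cast_injective
      have h12 : Matrix.of A * Matrix.of B = 1 := by
        apply hinj
        simp only [Matrix.map_mul, hA', hB', ← Units.val_mul, mul_inv_cancel, Units.val_one]
        simp
      have h21 : Matrix.of B * Matrix.of A = 1 := by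
        apply hinj
        simp only [Matrix.map_mul, hA', hB', ← Units.val_mul, inv_mul_cancel, Units.val_one]
        simp
      exact ⟨⟨Matrix.of A, Matrix.of B, h12, h21⟩, by ext1; exact hA'⟩
  rw [e]
  exact (hZ.preimage Units.continuous_val).inter
    (hZ.preimage (Units.continuous_val.comp continuous_inv))

instance : T2Space LatticeSpace := by
  rw [t2Space_iff_of_isOpenQuotientMap QuotientGroup.isOpenQuotientMap_mk]
  have : {x : GL (Fin 2) ℝ × GL (Fin 2) ℝ | (x.1 : LatticeSpace) = x.2} =
      (fun x => x.1⁻¹ * x.2) ⁻¹' (integralGL2 : Set (GL (Fin 2) ℝ)) := by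
    ext x
    exact QuotientGroup.eq
  rw [this]
  exact isClosed_integralGL2.preimage (by fun_prop)

/-! ### Supporting lines, caps, and the area of hexagons. -/

/-- Hahn–Banach at the open unit ball; every functional on the plane has the form `planeDet u`, so
supporting lines are encoded by vectors. -/
theorem IsPlaneNorm.exists_support {N : (Fin 2 → ℝ) → ℝ} (hN : IsPlaneNorm N) {p : Fin 2 → ℝ}
    (hp : N p = 1) : ∃ u, (∀ x, planeDet u x ≤ N x) ∧ planeDet u p = 1 := by
  have hconv : Convex ℝ {x | N x < 1} := by
    intro x hx y hy a b ha hb hab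
    have := hN.combination_le ha hb x y
    simp only [Set.mem_ofPred_eq] at hx hy ⊢
    rcases ha.eq_or_lt with rfl | ha
    · have : b = 1 := by linarith
      simpa [this] using hy
    · nlinarith
  obtain ⟨f, hf⟩ := geometric_hahn_banach_open_point hconv
    (isOpen_lt hN.continuous continuous_const) (x := p) (by simp [hp])
  have hf0 : 0 < f p := by
    have := hf 0 (by simp [hN.zero])
    rwa [map_zero] at this
  have hle : ∀ x, f x ≤ f p * N x := by
    intro x
    refine le_of_forall_pos_lt_add fun ε hε => ?_
    have hNx := hN.nonneg x
    set r := N x + ε / f p with hr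
    have hr0 : 0 < r := by positivity
    have := hf (r⁻¹ • x) (by
      simp only [Set.mem_ofPred_eq]
      rw [hN.smul_of_nonneg (by positivity), inv_mul_lt_iff₀ hr0, mul_one, hr]
      have : 0 < ε / f p := by positivity
      linarith)
    rw [map_smul, smul_eq_mul, inv_mul_lt_iff₀ hr0] at this
    calc f x < r * f p := this
      _ = f p * N x + ε := by rw [hr]; field_simp
  set u : Fin 2 → ℝ := (f p)⁻¹ • ![f (Pi.single 1 1), -f (Pi.single 0 1)] with hu
  have hux : ∀ x, planeDet u x = (f p)⁻¹ * f x := by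
    intro x
    have hx : x = x 0 • Pi.single 0 1 + x 1 • Pi.single 1 1 := by
      ext i
      fin_cases i <;> simp
    rw [hu, planeDet_smul_left]
    congr 1
    conv_rhs => rw [hx, map_add, map_smul, map_smul]
    simp [planeDet]
    ring
  refine ⟨u, fun x => ?_, ?_⟩
  · rw [hux, inv_mul_le_iff₀ hf0]
    exact hle x
  · rw [hux, inv_mul_cancel₀ hf0.ne']

theorem IsPlaneNorm.abs_planeDet_le {N : (Fin 2 → ℝ) → ℝ} (hN : IsPlaneNorm N) {u : Fin 2 → ℝ}
    (hu : ∀ x, planeDet u x ≤ N x) (x : Fin 2 → ℝ) : |planeDet u x| ≤ N x := by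
  refine abs_le'.2 ⟨hu x, ?_⟩
  have := hu (-x)
  rwa [planeDet_neg_right, hN.neg] at this

/-- Otherwise the midpoint has norm below 1 although the functional is at least 1 there. -/
theorem IsStrictNorm.eq_of_support {N : (Fin 2 → ℝ) → ℝ} (hs : IsStrictNorm N)
    {u p x : Fin 2 → ℝ} (hu : ∀ x, planeDet u x ≤ N x) (hp : N p = 1) (hx : N x = 1)
    (hup : 1 ≤ planeDet u p) (hux : 1 ≤ planeDet u x) : x = p := by
  by_contra hne
  have h1 := hs x p hx hp hne (1 / 2) (1 / 2) (by norm_num) (by norm_num) (by norm_num)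
  have h2 := hu ((1 / 2 : ℝ) • x + (1 / 2 : ℝ) • p)
  rw [planeDet_add_right, planeDet_smul_right, planeDet_smul_right] at h2
  linarith

theorem IsPlaneNorm.isCompact_le {N : (Fin 2 → ℝ) → ℝ} (hN : IsPlaneNorm N) (r : ℝ) :
    IsCompact {x | N x ≤ r} := by
  obtain ⟨c, hc, hcN⟩ := hN.exists_pos_mul_norm_le
  refine (isCompact_closedBall (0 : Fin 2 → ℝ) (r / c)).of_isClosed_subset
    (isClosed_le hN.continuous continuous_const) fun x hx => ?_
  rw [mem_closedBall_zero_iff, le_div_iff₀ hc, mul_comm]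
  exact (hcN x).trans hx

theorem IsSymmetricConvexDomain.inter_strip {K : Set (Fin 2 → ℝ)}
    (hK : IsSymmetricConvexDomain K) (u : Fin 2 → ℝ) {c : ℝ} (hc : 0 < c) :
    IsSymmetricConvexDomain (K ∩ {x | |planeDet u x| < c}) where
  isOpen := hK.isOpen.inter
    (isOpen_lt (continuous_const.planeDet continuous_id).abs continuous_const)
  nonempty := ⟨0, hK.zero_mem, by simpa [planeDet] using hc⟩
  convex := by
    refine hK.convex.inter fun x hx y hy a b ha hb hab => ?_
    simp only [Set.mem_ofPred_eq, abs_lt, planeDet_add_right, planeDet_smul_right] at hx hy ⊢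
    rcases ha.eq_or_lt with rfl | ha
    · have : b = 1 := by linarith
      simpa [this] using hy
    · have hb' : b = 1 - a := by linarith
      constructor <;> nlinarith
  isBounded := hK.isBounded.subset Set.inter_subset_left
  neg_mem x hx := ⟨hK.neg_mem x hx.1, by
    have := hx.2
    simp only [Set.mem_ofPred_eq] at this ⊢
    rwa [planeDet_neg_right, abs_neg]⟩

theorem IsSymmetricConvexDomain.exists_gauge_eq_one {K : Set (Fin 2 → ℝ)}
    (hK : IsSymmetricConvexDomain K) : ∃ p, gauge K p = 1 := by
  have h := hK.isPlaneNorm.pos 1 one_ne_zero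
  refine ⟨(gauge K 1)⁻¹ • 1, ?_⟩
  rw [hK.isPlaneNorm.smul_of_nonneg (inv_nonneg.2 h.le), inv_mul_cancel₀ h.ne']

theorem IsSymmetricConvexDomain.exists_isHexPair_lt {K : Set (Fin 2 → ℝ)}
    (hK : IsSymmetricConvexDomain K) {c : ℝ} (hc : criticalDeterminant K < c) :
    ∃ p q, IsHexPair (gauge K) p q ∧ planeDet p q < c := by
  obtain ⟨p, hp⟩ := hK.exists_gauge_eq_one
  obtain ⟨q, hq⟩ := exists_isHexPair hK.isPlaneNorm hp
  obtain ⟨_, ⟨Λ, hΛ, rfl⟩, hlt⟩ := exists_lt_of_csInf_lt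
    (Set.Nonempty.image _ (s := {Λ | IsAdmissible K Λ}) ⟨_, hq.isAdmissible hK⟩) hc
  obtain ⟨p, q, hpq, hle⟩ := hΛ.exists_isHexPair_planeDet_le hK
  exact ⟨p, q, hpq, hle.trans_lt hlt⟩

/-- Cutting a small cap off an irreducible domain leaves an inscribed hexagon of small area with
a vertex in the cap. -/
theorem exists_isHexPair_inter_strip {K : Set (Fin 2 → ℝ)} (hK : IsSymmetricConvexDomain K)
    (hirr : IsIrreducibleDomain K) {p u : Fin 2 → ℝ} (hp : gauge K p = 1)
    (hup : planeDet u p = 1) {c : ℝ} (hc0 : 0 < c) (hc1 : c < 1) :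
    ∃ a b, IsHexPair (gauge (K ∩ {x | |planeDet u x| < c})) a b ∧
      planeDet a b < criticalDeterminant K ∧ c ≤ planeDet u a := by
  set C := K ∩ {x | |planeDet u x| < c} with hC
  have hN := hK.isPlaneNorm
  have hCd : IsSymmetricConvexDomain C := hK.inter_strip u hc0
  have hNC := hCd.isPlaneNorm
  have hlt : criticalDeterminant C < criticalDeterminant K := by
    refine hirr C hCd (Set.ssubset_iff_subset_ne.2 ⟨Set.inter_subset_left, fun h => ?_⟩)
    have h1 : c • p ∈ K := by
      rw [← hK.gauge_lt_one, hN.smul_of_nonneg hc0.le, hp, mul_one]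
      exact hc1
    rw [← h, hC] at h1
    have h2 : |planeDet u (c • p)| < c := h1.2
    rw [planeDet_smul_right, hup, mul_one, abs_of_pos hc0] at h2
    exact lt_irrefl _ h2
  obtain ⟨a, b, hab, hd⟩ := hCd.exists_isHexPair_lt hlt
  -- A unit vector for `C` that is not one for `K` lies in `K`, so only the strip can keep it out of
  -- `C`.
  have hcap : ∀ v, gauge C v = 1 → gauge K v ≠ 1 → c ≤ |planeDet u v| := by
    intro v hv hne
    have h1 : gauge K v ≤ 1 := (hCd.gauge_le_of_subset Set.inter_subset_left v).trans hv.le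
    have h2 : v ∈ K := hK.gauge_lt_one.1 (lt_of_le_of_ne h1 hne)
    by_contra! h3
    have : v ∈ C := ⟨h2, h3⟩
    exact (hCd.gauge_lt_one.2 this).ne hv
  have key : ∀ a b, IsHexPair (gauge C) a b → planeDet a b < criticalDeterminant K →
      gauge K a ≠ 1 → ∃ a b, IsHexPair (gauge C) a b ∧
      planeDet a b < criticalDeterminant K ∧ c ≤ planeDet u a := by
    intro a b hab hd hne
    rcases le_abs'.1 (hcap a hab.left hne) with h | h
    · refine ⟨-a, -b, hab.neg hNC, ?_, ?_⟩
      · rwa [show planeDet (-a) (-b) = planeDet a b by simp [planeDet]]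
      · rw [planeDet_neg_right]
        linarith
    · exact ⟨a, b, hab, hd, h⟩
  -- With no vertex on the cut the hexagon would be inscribed in `K`, and too small.
  by_contra hnot
  have h1 : gauge K a = 1 := by
    by_contra hne
    exact hnot (key a b hab hd hne)
  have h2 : gauge K b = 1 := by
    by_contra hne
    exact hnot (key _ _ (hab.rotate hNC) (by rwa [planeDet_rotate]) hne)
  have h3 : gauge K (b - a) = 1 := by
    by_contra hne
    exact hnot (key _ _ ((hab.rotate hNC).rotate hNC)
      (by rwa [planeDet_rotate, planeDet_rotate]) hne)
  exact hd.not_ge (IsHexPair.criticalDeterminant_le hK ⟨h1, h2, h3, hab.pos⟩)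

/-- All hexagons of the given kind in a strictly convex irreducible domain have the same area. -/
theorem IsHexPair.planeDet_eq {K : Set (Fin 2 → ℝ)} (hK : IsSymmetricConvexDomain K)
    (hs : HasStrictlyConvexBoundary K) (hirr : IsIrreducibleDomain K) {p q : Fin 2 → ℝ}
    (h : IsHexPair (gauge K) p q) : planeDet p q = criticalDeterminant K := by
  refine le_antisymm ?_ (h.criticalDeterminant_le hK)
  have hN := hK.isPlaneNorm
  obtain ⟨u, hu, hup⟩ := hN.exists_support h.left
  -- The shift by two keeps `c 0` positive.
  set c : ℕ → ℝ := fun n => 1 - 1 / ((n + 1 : ℕ) + 1) with hc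
  have hc0 : ∀ n, 0 < c n := by
    intro n
    have : (0 : ℝ) ≤ n := n.cast_nonneg
    simp only [hc, sub_pos]
    rw [div_lt_one (by positivity)]
    push_cast
    linarith
  have hc1 : ∀ n, c n < 1 := by
    intro n
    simp only [hc, sub_lt_self_iff]
    positivity
  have hclim : Filter.Tendsto c Filter.atTop (nhds 1) := by
    have := (tendsto_one_div_add_atTop_nhds_zero_nat (𝕜 := ℝ)).comp (Filter.tendsto_add_atTop_nat 1)
    simpa [hc, Function.comp_def] using this.const_sub 1
  choose a b hab hd hua using fun n =>
    exists_isHexPair_inter_strip hK hirr h.left hup (hc0 n) (hc1 n)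
  -- The cut domain contains the ball `gauge K < c n`, so its unit vectors approach the unit sphere
  -- of `K`.
  have hnorm : ∀ n v, gauge (K ∩ {x | |planeDet u x| < c n}) v = 1 →
      c n ≤ gauge K v ∧ gauge K v ≤ 1 := by
    intro n v hv
    have hCd := hK.inter_strip u (hc0 n)
    refine ⟨?_, (hCd.gauge_le_of_subset Set.inter_subset_left v).trans hv.le⟩
    by_contra! hlt
    have : v ∈ K ∩ {x | |planeDet u x| < c n} :=
      ⟨hK.gauge_lt_one.1 (hlt.trans (hc1 n)), (hN.abs_planeDet_le hu v).trans_lt hlt⟩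
    exact (hCd.gauge_lt_one.2 this).ne hv
  obtain ⟨⟨x, y⟩, -, φ, hφ, hlim⟩ := ((hN.isCompact_le 1).prod (hN.isCompact_le 1)).tendsto_subseq
    (x := fun n => (a n, b n))
    fun n => ⟨(hnorm n _ (hab n).left).2, (hnorm n _ (hab n).right).2⟩
  have hx : Filter.Tendsto (a ∘ φ) Filter.atTop (nhds x) := hlim.fst_nhds
  have hy : Filter.Tendsto (b ∘ φ) Filter.atTop (nhds y) := hlim.snd_nhds
  have hcφ := hclim.comp hφ.tendsto_atTop
  have hone : ∀ (v : ℕ → Fin 2 → ℝ) (z : Fin 2 → ℝ),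
      (∀ n, gauge (K ∩ {x | |planeDet u x| < c n}) (v n) = 1) →
      Filter.Tendsto (v ∘ φ) Filter.atTop (nhds z) → gauge K z = 1 := by
    intro v z hv hz
    have h1 := (hN.continuous.tendsto z).comp hz
    exact le_antisymm (le_of_tendsto' h1 fun n => (hnorm _ _ (hv _)).2)
      (le_of_tendsto_of_tendsto' hcφ h1 fun n => (hnorm _ _ (hv _)).1)
  have hNx := hone a x (fun n => (hab n).left) hx
  have hNy := hone b y (fun n => (hab n).right) hy
  have hNyx := hone (fun n => b n - a n) (y - x) (fun n => (hab n).sub) (hy.sub hx)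
  have hdet : Filter.Tendsto (fun n => planeDet (a (φ n)) (b (φ n))) Filter.atTop
      (nhds (planeDet x y)) :=
    ((continuous_fst.planeDet continuous_snd).tendsto (x, y)).comp hlim
  have hpos : 0 < planeDet x y := lt_of_le_of_ne
    (ge_of_tendsto' hdet fun n => (hab _).pos.le) (hN.planeDet_ne_zero hNx hNy hNyx).symm
  have hux : 1 ≤ planeDet u x := le_of_tendsto_of_tendsto' hcφ
    (((continuous_const.planeDet continuous_id).tendsto x).comp hx) fun n => hua _
  -- The limit vertex lies on the supporting line at `p`, which touches only at `p`.
  obtain rfl : x = p := (hK.isStrictNorm hs).eq_of_support hu h.left hNx hup.ge hux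
  exact (h.planeDet_le hN ⟨hNx, hNy, hNyx, hpos⟩).trans
    (le_of_tendsto' hdet fun n => (hd _).le)

/-- The critical lattices of a strictly convex irreducible domain are those of the inscribed
hexagons. -/
theorem mem_criticalLocus_iff {K : Set (Fin 2 → ℝ)} (hK : IsSymmetricConvexDomain K)
    (hs : HasStrictlyConvexBoundary K) (hirr : IsIrreducibleDomain K) {Λ : LatticeSpace} :
    Λ ∈ criticalLocus K ↔
      ∃ p q, ∃ h : IsHexPair (gauge K) p q, Λ = latticeOfBasis ⟨(p, q), h.ne_zero⟩ := by
  refine ⟨exists_eq_latticeOfBasis hK hs, ?_⟩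
  rintro ⟨p, q, h, rfl⟩
  refine ⟨h.isAdmissible hK, ?_⟩
  rw [latticeCovolume_latticeOfBasis, abs_of_pos h.pos, h.planeDet_eq hK hs hirr]

/-! ### The critical locus as a circle. -/

theorem isCompact_setOf_isHexPair {N : (Fin 2 → ℝ) → ℝ} (hN : IsPlaneNorm N) :
    IsCompact {x : (Fin 2 → ℝ) × (Fin 2 → ℝ) | IsHexPair N x.1 x.2} := by
  have e : {x : (Fin 2 → ℝ) × (Fin 2 → ℝ) | IsHexPair N x.1 x.2} =
      {x | N x.1 = 1} ∩ {x | N x.2 = 1} ∩ {x | N (x.2 - x.1) = 1} ∩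
        {x | 0 ≤ planeDet x.1 x.2} := by
    ext x
    constructor
    · intro h
      exact ⟨⟨⟨h.left, h.right⟩, h.sub⟩, h.pos.le⟩
    · rintro ⟨⟨⟨h1, h2⟩, h3⟩, h4⟩
      exact ⟨h1, h2, h3, lt_of_le_of_ne h4 (hN.planeDet_ne_zero h1 h2 h3).symm⟩
  have hc := hN.continuous
  refine ((hN.isCompact_le 1).prod (hN.isCompact_le 1)).of_isClosed_subset ?_ ?_
  · rw [e]
    exact (((isClosed_eq (hc.comp continuous_fst) continuous_const).inter
      (isClosed_eq (hc.comp continuous_snd) continuous_const)).inter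
      (isClosed_eq (hc.comp (continuous_snd.sub continuous_fst)) continuous_const)).inter
      (isClosed_le continuous_const (continuous_fst.planeDet continuous_snd))
  · intro x h
    exact ⟨h.left.le, h.right.le⟩

/-- The second vertex of the inscribed hexagon depends continuously on the first one. -/
theorem exists_continuous_isHexPair {N : (Fin 2 → ℝ) → ℝ} (hN : IsPlaneNorm N)
    (hs : IsStrictNorm N) :
    ∃ Q : {p // N p = 1} → Fin 2 → ℝ, Continuous Q ∧ ∀ p : {p // N p = 1}, IsHexPair N p (Q p) := by
  have : CompactSpace {x : (Fin 2 → ℝ) × (Fin 2 → ℝ) // IsHexPair N x.1 x.2} :=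
    isCompact_iff_compactSpace.1 (isCompact_setOf_isHexPair hN)
  let f : {x : (Fin 2 → ℝ) × (Fin 2 → ℝ) // IsHexPair N x.1 x.2} → {p // N p = 1} :=
    fun x => ⟨x.1.1, x.2.left⟩
  have hf : Continuous f := (continuous_fst.comp continuous_subtype_val).subtype_mk _
  -- Existence and uniqueness of hexagons make the projection to the first vertex a continuous
  -- bijection from a compact space, hence a homeomorphism.
  have hbij : Function.Bijective f := by
    constructor
    · rintro ⟨⟨p, q⟩, h⟩ ⟨⟨p', q'⟩, h'⟩ he
      obtain rfl : p = p' := congrArg Subtype.val he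
      obtain rfl : q = q' := h.unique hN hs h'
      rfl
    · rintro ⟨p, hp⟩
      obtain ⟨q, hq⟩ := exists_isHexPair hN hp
      exact ⟨⟨(p, q), hq⟩, rfl⟩
  let e := hf.homeoOfEquivCompactToT2 (f := Equiv.ofBijective f hbij)
  refine ⟨fun p => (e.symm p).1.2,
    continuous_snd.comp (continuous_subtype_val.comp e.symm.continuous), fun p => ?_⟩
  have h1 : ((e.symm p).1.1 : Fin 2 → ℝ) = p := congrArg Subtype.val (e.apply_symm_apply p)
  have h2 := (e.symm p).2
  rwa [h1] at h2

/-- The lattice generated by an inscribed hexagon. -/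
noncomputable def IsHexPair.lattice {N : (Fin 2 → ℝ) → ℝ} {p q : Fin 2 → ℝ}
    (h : IsHexPair N p q) : LatticeSpace :=
  latticeOfBasis ⟨(p, q), h.ne_zero⟩

theorem IsHexPair.mem_lattice {N : (Fin 2 → ℝ) → ℝ} {p q x : Fin 2 → ℝ}
    (h : IsHexPair N p q) : x ∈ latticePoints h.lattice ↔ ∃ m n : ℤ, x = m • p + n • q :=
  mem_latticePoints_latticeOfBasis _

theorem IsHexPair.lattice_rotate {N : (Fin 2 → ℝ) → ℝ} (hN : IsPlaneNorm N) {p q : Fin 2 → ℝ}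
    (h : IsHexPair N p q) : (h.rotate hN).lattice = h.lattice := by
  refine (eq_latticeOfBasis _ (h.mem_lattice.2 ⟨0, 1, by simp⟩)
    (h.mem_lattice.2 ⟨-1, 1, ?_⟩) ?_).symm
  · rw [neg_smul, one_smul, one_smul, neg_add_eq_sub]
  · rw [planeDet_rotate]
    exact latticeCovolume_latticeOfBasis _

theorem IsHexPair.left_mem_lattice {N : (Fin 2 → ℝ) → ℝ} {p q : Fin 2 → ℝ}
    (h : IsHexPair N p q) : p ∈ latticePoints h.lattice := h.mem_lattice.2 ⟨1, 0, by simp⟩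

/-- A half-open sector of an inscribed hexagon contains no `p, q` from a hexagon of the same
area. -/
theorem IsHexPair.not_isHexPair_sector {N : (Fin 2 → ℝ) → ℝ} (hN : IsPlaneNorm N)
    (hs : IsStrictNorm N) {p q : Fin 2 → ℝ} (h : IsHexPair N p q) {a b c d : ℝ} (ha : 0 < a)
    (hb : 0 ≤ b) (hc : 0 < c) (hd : 0 ≤ d)
    (h' : IsHexPair N (a • p + b • q) (c • p + d • q))
    (hdet : planeDet (a • p + b • q) (c • p + d • q) = planeDet p q) : False := by
  rw [planeDet_combination] at hdet
  have hdet1 : a * d - b * c = 1 := mul_right_cancel₀ h.ne_zero (by rw [hdet, one_mul])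
  have h1 := h.coord_le hN ha.le hb
  have h2 := h.coord_le hN hc.le hd
  rw [h'.left] at h1
  rw [h'.right] at h2
  have hbc : 0 ≤ b * c := by positivity
  -- From `a, d ≤ 1` and `a * d = 1 + b * c ≥ 1`; the second vector is then `q + c • p` with `c >
  -- 0`, which strictness excludes.
  have hd1 : d = 1 := by nlinarith
  have := h'.right
  rw [hd1, one_smul, add_comm] at this
  exact hs.add_smul_ne_one h.left_ne_zero h.sub h.right hc this

/-- Every nonzero vector lies in one of the six sectors of a hexagon. -/
theorem IsHexPair.exists_sector {N : (Fin 2 → ℝ) → ℝ} (hN : IsPlaneNorm N) {p q : Fin 2 → ℝ}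
    (h : IsHexPair N p q) {x : Fin 2 → ℝ} (hx : x ≠ 0) :
    ∃ p' q', ∃ h' : IsHexPair N p' q', h'.lattice = h.lattice ∧
      ∃ a b : ℝ, 0 < a ∧ 0 ≤ b ∧ x = a • p' + b • q' := by
  have hx' := eq_combination_of_planeDet_ne_zero h.ne_zero x
  set a := planeDet x q / planeDet p q
  set b := planeDet p x / planeDet p q
  have hab : a ≠ 0 ∨ b ≠ 0 := by
    by_contra! h0
    rw [h0.1, h0.2] at hx'
    simp at hx'
    exact hx hx'
  rw [hx']
  refine sector_induction (T := fun a b : ℝ => ∀ p q, ∀ h : IsHexPair N p q,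
    ∃ p' q', ∃ h' : IsHexPair N p' q', h'.lattice = h.lattice ∧
      ∃ a' b' : ℝ, 0 < a' ∧ 0 ≤ b' ∧ a • p + b • q = a' • p' + b' • q') ?_ ?_ a b hab p q h
  · intro a b ha hb p q h
    exact ⟨p, q, h, rfl, a, b, ha, hb, rfl⟩
  · intro a b IH p q h
    obtain ⟨p', q', h', hl, a', b', ha', hb', he⟩ := IH _ _ (h.rotate hN)
    exact ⟨p', q', h', hl.trans (h.lattice_rotate hN), a', b', ha', hb', by
      rw [← he, combination_rotate]⟩

/-- Take the sector `(p', q')` of the other hexagon that contains `p₀`. Either `p' = p₀`, or `q'`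
lies in the sector of `(p₀, q₀)`; if `q'` came after `q₀`, both `p₀` and `q₀` would lie in the
sector of `(p', q')`. -/
theorem IsHexPair.exists_mem_sector {N : (Fin 2 → ℝ) → ℝ} (hN : IsPlaneNorm N)
    (hs : IsStrictNorm N) (hdet : ∀ p q p' q', IsHexPair N p q → IsHexPair N p' q' →
      planeDet p q = planeDet p' q') {p q p₀ q₀ : Fin 2 → ℝ}
    (h : IsHexPair N p q) (h₀ : IsHexPair N p₀ q₀) :
    ∃ a b : ℝ, 0 < a ∧ 0 ≤ b ∧ ∃ r, ∃ h' : IsHexPair N (a • p₀ + b • q₀) r,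
      h'.lattice = h.lattice := by
  obtain ⟨p', q', h', hl, α, β, hα, hβ, he⟩ := h.exists_sector hN h₀.left_ne_zero
  have hp₀ : ∀ q', ∀ h' : IsHexPair N p₀ q', h'.lattice = h.lattice →
      ∃ a b : ℝ, 0 < a ∧ 0 ≤ b ∧ ∃ r, ∃ h' : IsHexPair N (a • p₀ + b • q₀) r,
      h'.lattice = h.lattice := by
    intro q' h' hl
    have e : p₀ = (1 : ℝ) • p₀ + (0 : ℝ) • q₀ := by simp
    exact ⟨1, 0, one_pos, le_rfl, q', e ▸ h', by simpa using hl⟩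
  have hone : ∀ (c : ℝ) (x y : Fin 2 → ℝ), N x = 1 → N y = 1 → 0 < c → x = c • y → x = y := by
    intro c x y hx hy hc he
    rw [he, hN.smul_of_nonneg hc.le, hy, mul_one] at hx
    rw [he, hx, one_smul]
  rcases hβ.eq_or_lt with rfl | hβ
  · rw [zero_smul, add_zero] at he
    obtain rfl := hone _ _ _ h₀.left h'.left hα he
    exact hp₀ _ h' hl
  have hq' := eq_combination_of_planeDet_ne_zero h₀.ne_zero q'
  set c := planeDet q' q₀ / planeDet p₀ q₀
  have hd : 0 < planeDet p₀ q' / planeDet p₀ q₀ := by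
    refine div_pos ?_ h₀.pos
    have : planeDet p₀ q' = α * planeDet p' q' := by
      rw [he]; simp [planeDet]; ring
    rw [this]
    exact mul_pos hα h'.pos
  set d := planeDet p₀ q' / planeDet p₀ q₀
  rcases lt_trichotomy c 0 with hc | hc | hc
  · exfalso
    have hq₀ : q₀ = (-c * α / d) • p' + ((1 - c * β) / d) • q' := by
      have h1 : d • q₀ = (-c * α) • p' + (1 - c * β) • q' := by
        have : d • q₀ = q' - c • p₀ := by
          exact eq_sub_of_add_eq' hq'.symm
        rw [this, he]
        module
      rw [div_eq_inv_mul, div_eq_inv_mul, mul_smul d⁻¹, mul_smul d⁻¹, ← smul_add, ← h1,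
        inv_smul_smul₀ hd.ne']
    have h₀' := h₀
    rw [he, hq₀] at h₀'
    have hcα : 0 < -c * α := mul_pos (neg_pos.2 hc) hα
    have hcβ : 0 < 1 - c * β := by nlinarith
    exact h'.not_isHexPair_sector hN hs hα hβ.le (by positivity) (by positivity) h₀'
      (hdet _ _ _ _ h₀' h')
  · rw [hc, zero_smul, zero_add] at hq'
    obtain rfl := hone _ _ _ h'.right h₀.right hd hq'
    have h2 := (h'.rotate hN).unique hN hs (h₀.rotate hN)
    obtain rfl : p' = p₀ := by simpa using h2
    exact hp₀ _ h' hl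
  · exact ⟨c, d, hc, hd.le, q' - p', hq' ▸ h'.rotate hN, by
      rw [← hl, ← h'.lattice_rotate hN]
      congr 1
      exact hq'.symm⟩

/-- By `eq_vertex`, `p'` is a vertex of the hexagon of `(p, q)`. Were it not `p`, the sector would
contain two consecutive vertices or two opposite ones; if `p' = q - p`, it contains `q = p + p'`. -/
theorem IsHexPair.sector_injective {N : (Fin 2 → ℝ) → ℝ} (hN : IsPlaneNorm N)
    (hs : IsStrictNorm N) (hdet : ∀ p q p' q', IsHexPair N p q → IsHexPair N p' q' →
      planeDet p q = planeDet p' q') {p q p' q' p₀ q₀ : Fin 2 → ℝ} (h₀ : IsHexPair N p₀ q₀)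
    (h : IsHexPair N p q) (h' : IsHexPair N p' q') (hl : h.lattice = h'.lattice)
    (hp : ∃ a b : ℝ, 0 < a ∧ 0 ≤ b ∧ p = a • p₀ + b • q₀)
    (hp' : ∃ a b : ℝ, 0 < a ∧ 0 ≤ b ∧ p' = a • p₀ + b • q₀) : p = p' := by
  wlog hpos : 0 ≤ planeDet p p' generalizing p q p' q'
  · refine (this h' h hl.symm hp' hp ?_).symm
    have : planeDet p' p = -planeDet p p' := by simp [planeDet]; ring
    linarith
  have hmem : p' ∈ latticePoints h.lattice := hl ▸ h'.left_mem_lattice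
  obtain ⟨m, n, hmn⟩ := h.mem_lattice.1 hmem
  obtain ⟨v, hv, hpv⟩ := h.eq_vertex hN hs m n (hmn ▸ h'.left)
  rw [← hmn] at hpv
  obtain ⟨a, b, ha, hb, hpe⟩ := hp
  obtain ⟨a', b', ha', hb', hpe'⟩ := hp'
  have hnot : ∀ r, IsHexPair N p r → ∀ c d : ℝ, 0 < c → 0 ≤ d → r = c • p₀ + d • q₀ → False := by
    intro r hr c d hc hd hre
    rw [hpe, hre] at hr
    exact h₀.not_isHexPair_sector hN hs ha hb hc hd hr (hdet _ _ _ _ hr h₀)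
  have hposq := h.pos
  rcases hv with rfl | rfl | rfl <;> rcases hpv with hpv | hpv
  · exact hpv.symm
  · exfalso
    have h1 : planeDet v q₀ = a * planeDet p₀ q₀ := by rw [hpe]; simp [planeDet]; ring
    have h2 : planeDet p' q₀ = a' * planeDet p₀ q₀ := by rw [hpe']; simp [planeDet]; ring
    have h3 : planeDet p' q₀ = -planeDet v q₀ := by rw [hpv]; simp [planeDet]; ring
    have := mul_pos ha h₀.pos
    have := mul_pos ha' h₀.pos
    linarith
  · exact (hnot v h a' b' ha' hb' (hpv ▸ hpe')).elim
  · rw [hpv, planeDet_neg_right] at hpos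
    linarith
  · refine (hnot q h (a + a') (b + b') (by positivity) (by positivity) ?_).elim
    have : q = p + p' := by rw [hpv]; abel
    rw [this, hpe, hpe']
    module
  · rw [hpv, planeDet_neg_right, planeDet_sub_right, planeDet_self] at hpos
    linarith

theorem exists_embedding_circle {K : Set (Fin 2 → ℝ)} (hK : IsSymmetricConvexDomain K)
    (hstrict : HasStrictlyConvexBoundary K) (hirr : IsIrreducibleDomain K) :
    ∃ φ : Circle → LatticeSpace, Topology.IsEmbedding φ ∧ Set.range φ = criticalLocus K := by
  have hN := hK.isPlaneNorm
  have hs := hK.isStrictNorm hstrict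
  have hdet : ∀ p q p' q', IsHexPair (gauge K) p q → IsHexPair (gauge K) p' q' →
      planeDet p q = planeDet p' q' := fun p q p' q' h h' => by
    rw [h.planeDet_eq hK hstrict hirr, h'.planeDet_eq hK hstrict hirr]
  obtain ⟨p₀, hp₀⟩ := hK.exists_gauge_eq_one
  obtain ⟨q₀, h₀⟩ := exists_isHexPair hN hp₀
  obtain ⟨Q, hQc, hQ⟩ := exists_continuous_isHexPair hN hs
  set c : ℝ → Fin 2 → ℝ := fun t => (1 - t) • p₀ + t • q₀ with hc
  have hcc : Continuous c := by fun_prop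
  have hc0 : ∀ t, 0 < gauge K (c t) := by
    refine fun t => hN.pos _ (combination_ne_zero h₀.ne_zero ?_)
    by_contra! h
    linarith
  set γ : ℝ → {p // gauge K p = 1} := fun t => ⟨(gauge K (c t))⁻¹ • c t, by
    rw [hN.smul_of_nonneg (inv_nonneg.2 (hc0 t).le), inv_mul_cancel₀ (hc0 t).ne']⟩ with hγ
  have hγc : Continuous γ :=
    (((hN.continuous.comp hcc).inv₀ fun t => (hc0 t).ne').smul hcc).subtype_mk _
  set Ψ : ℝ → LatticeSpace := fun t => (hQ (γ t)).lattice with hΨ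
  have hΨc : Continuous Ψ := continuous_latticeOfBasis.comp
    (((continuous_subtype_val.comp hγc).prodMk (hQc.comp hγc)).subtype_mk _)
  have hlat : ∀ {p q p' q'} (h : IsHexPair (gauge K) p q) (h' : IsHexPair (gauge K) p' q'),
      p = p' → h.lattice = h'.lattice := by
    rintro p q p' q' h h' rfl
    obtain rfl := h.unique hN hs h'
    rfl
  have hγ0 : (γ 0 : Fin 2 → ℝ) = p₀ := by simp [hγ, hc, hp₀]
  have hγ1 : (γ 1 : Fin 2 → ℝ) = q₀ := by simp [hγ, hc, h₀.right]
  have hΨ01 : Ψ 0 = Ψ 1 := by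
    rw [hΨ]
    simp only
    rw [hlat (hQ (γ 0)) h₀ hγ0, hlat (hQ (γ 1)) (h₀.rotate hN) hγ1, h₀.lattice_rotate hN]
  have hγe : ∀ t, (γ t : Fin 2 → ℝ) =
      ((gauge K (c t))⁻¹ * (1 - t)) • p₀ + ((gauge K (c t))⁻¹ * t) • q₀ := by
    intro t
    simp only [hγ, hc, smul_add, smul_smul]
  have hγsec : ∀ t ∈ Set.Ico (0 : ℝ) 1, ∃ a b : ℝ, 0 < a ∧ 0 ≤ b ∧
      (γ t : Fin 2 → ℝ) = a • p₀ + b • q₀ := fun t ht =>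
    ⟨_, _, mul_pos (inv_pos.2 (hc0 t)) (sub_pos.2 ht.2),
      mul_nonneg (inv_nonneg.2 (hc0 t).le) ht.1, hγe t⟩
  have hinj : Set.InjOn Ψ (Set.Ico 0 1) := by
    intro s hs' t ht hst
    have h1 := IsHexPair.sector_injective hN hs hdet h₀ (hQ (γ s)) (hQ (γ t)) hst
      (hγsec s hs') (hγsec t ht)
    rw [hγe, hγe] at h1
    set k := (gauge K (c s))⁻¹ with hk
    set k' := (gauge K (c t))⁻¹
    have hkpos : 0 < k := inv_pos.2 (hc0 s)
    have h2 : (k * (1 - s) - k' * (1 - t)) • p₀ + (k * s - k' * t) • q₀ = 0 := by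
      rw [← sub_eq_zero] at h1
      rw [← h1]
      module
    have h3 : ¬ (k * (1 - s) - k' * (1 - t) ≠ 0 ∨ k * s - k' * t ≠ 0) :=
      fun h => combination_ne_zero h₀.ne_zero h h2
    push Not at h3
    -- The two coordinates of `γ t` add up to the inverse gauge of `c t`.
    have hkk : k = k' := by linarith [h3.1, h3.2]
    have := h3.2
    rw [← hkk, ← mul_sub] at this
    rcases mul_eq_zero.1 this with h | h
    · exact absurd h hkpos.ne'
    · linarith
  have hcrit : Ψ '' Set.Ico 0 1 = criticalLocus K := by
    ext Λ
    rw [mem_criticalLocus_iff hK hstrict hirr]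
    constructor
    · rintro ⟨t, -, rfl⟩
      exact ⟨_, _, hQ (γ t), rfl⟩
    · rintro ⟨p, q, h, rfl⟩
      obtain ⟨a, b, ha, hb, r, h', hl⟩ := h.exists_mem_sector hN hs hdet h₀
      have hab : 0 < a + b := by positivity
      -- The point where the ray through the vertex crosses the segment from `p₀` to `q₀`.
      refine ⟨b / (a + b), ⟨by positivity, (div_lt_one hab).2 (by linarith)⟩, ?_⟩
      change _ = h.lattice
      rw [← hl]
      refine hlat _ _ ?_
      have e : c (b / (a + b)) = (a + b)⁻¹ • (a • p₀ + b • q₀) := by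
        simp only [hc]
        match_scalars <;> field_simp
        ring
      change (gauge K (c (b / (a + b))))⁻¹ • c (b / (a + b)) = _
      rw [e, hN.smul_of_nonneg (by positivity), h'.left, mul_one, inv_inv, smul_smul,
        mul_inv_cancel₀ hab.ne', one_smul]
  have : Fact ((0 : ℝ) < 1) := ⟨one_pos⟩
  set f : AddCircle (1 : ℝ) → LatticeSpace := AddCircle.liftIco 1 0 Ψ with hf
  have hfc : Continuous f := AddCircle.liftIco_zero_continuous hΨ01 hΨc.continuousOn
  have hfΨ : ∀ t ∈ Set.Ico (0 : ℝ) 1, f t = Ψ t := fun t ht => AddCircle.liftIco_zero_coe_apply ht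
  have hrep : ∀ x : AddCircle (1 : ℝ), ∃ t ∈ Set.Ico (0 : ℝ) 1, (t : AddCircle (1 : ℝ)) = x := by
    intro x
    have := AddCircle.coe_image_Ico_eq (1 : ℝ) 0
    rw [zero_add] at this
    exact (Set.ext_iff.1 this x).2 (Set.mem_univ x)
  have hfinj : Function.Injective f := by
    intro x y hxy
    obtain ⟨s, hs, rfl⟩ := hrep x
    obtain ⟨t, ht, rfl⟩ := hrep y
    rw [hfΨ s hs, hfΨ t ht] at hxy
    rw [hinj hs ht hxy]
  refine ⟨f ∘ (AddCircle.homeomorphCircle one_ne_zero).symm,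
    (hfc.isClosedEmbedding hfinj).isEmbedding.comp (Homeomorph.isEmbedding _), ?_⟩
  rw [(Homeomorph.surjective _).range_comp, ← hcrit]
  ext Λ
  constructor
  · rintro ⟨x, rfl⟩
    obtain ⟨t, ht, rfl⟩ := hrep x
    exact ⟨t, ht, (hfΨ t ht).symm⟩
  · rintro ⟨t, ht, rfl⟩
    exact ⟨t, hfΨ t ht⟩

/-! ### Domains with prescribed critical locus. -/

/-- The points `x` strictly inside all supporting strips of the unit ball of `N` at the points
of `S`, with `N x < 2`. -/
def strictSupportDomain (N : (Fin 2 → ℝ) → ℝ) (S : Set (Fin 2 → ℝ)) : Set (Fin 2 → ℝ) :=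
  {x | N x < 2 ∧ ∀ u, (∀ y, planeDet u y ≤ N y) → (∃ s ∈ S, planeDet u s = 1) → planeDet u x < 1}

theorem IsPlaneNorm.isCompact_polar {N : (Fin 2 → ℝ) → ℝ} (hN : IsPlaneNorm N) :
    IsCompact {u | ∀ y, planeDet u y ≤ N y} := by
  have hclosed : IsClosed {u | ∀ y, planeDet u y ≤ N y} := by
    simp only [Set.ofPred_forall]
    exact isClosed_iInter fun y =>
      isClosed_le (continuous_id.planeDet continuous_const) continuous_const
  set R := max (N (Pi.single 0 1)) (N (Pi.single 1 1))
  refine (isCompact_closedBall (0 : Fin 2 → ℝ) R).of_isClosed_subset hclosed fun u hu => ?_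
  rw [mem_closedBall_zero_iff, pi_norm_le_iff_of_nonneg ((hN.nonneg _).trans (le_max_left _ _))]
  intro i
  have h0 := hN.abs_planeDet_le hu (Pi.single 0 1)
  have h1 := hN.abs_planeDet_le hu (Pi.single 1 1)
  simp [planeDet] at h0 h1
  fin_cases i
  · exact h1.trans (le_max_right _ _)
  · exact h0.trans (le_max_left _ _)

/-- Infinitely many open half-planes are intersected; openness survives because the pairs of a
support and a contact point in `S` form a compact set. -/
theorem IsPlaneNorm.isOpen_strictSupportDomain {N : (Fin 2 → ℝ) → ℝ} (hN : IsPlaneNorm N)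
    {S : Set (Fin 2 → ℝ)} (hS : IsCompact S) : IsOpen (strictSupportDomain N S) := by
  set P := ({u | ∀ y, planeDet u y ≤ N y} ×ˢ S) ∩ {x | planeDet x.1 x.2 = 1} with hP
  have hPc : IsCompact P := (hN.isCompact_polar.prod hS).inter_right
    (isClosed_eq (continuous_fst.planeDet continuous_snd) continuous_const)
  have e : strictSupportDomain N S =
      {x | N x < 2} ∩ {x | ∀ y ∈ P, planeDet y.1 x < 1} := by
    ext x
    refine and_congr_right fun _ => ⟨?_, ?_⟩
    · rintro h ⟨u, s⟩ ⟨⟨hu, hs⟩, hus⟩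
      exact h u hu ⟨s, hs, hus⟩
    · rintro h u hu ⟨s, hs, hus⟩
      exact h (u, s) ⟨⟨hu, hs⟩, hus⟩
  rw [e]
  refine (isOpen_lt hN.continuous continuous_const).inter (isOpen_iff_eventually.2 fun x hx => ?_)
  refine hPc.eventually_forall_of_forall_eventually fun y hy => ?_
  exact (isOpen_lt ((continuous_fst.comp continuous_snd).planeDet continuous_fst)
    continuous_const).eventually_mem (hx y hy)

theorem IsSymmetricConvexDomain.subset_strictSupportDomain {K : Set (Fin 2 → ℝ)}
    (hK : IsSymmetricConvexDomain K) (S : Set (Fin 2 → ℝ)) :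
    K ⊆ strictSupportDomain (gauge K) S := by
  intro x hx
  have hx1 := hK.gauge_lt_one.2 hx
  exact ⟨by linarith, fun u hu _ => (hu x).trans_lt hx1⟩

theorem IsSymmetricConvexDomain.strictSupportDomain {K : Set (Fin 2 → ℝ)}
    (hK : IsSymmetricConvexDomain K) {S : Set (Fin 2 → ℝ)} (hS : IsCompact S)
    (hSneg : ∀ s ∈ S, -s ∈ S) : IsSymmetricConvexDomain (strictSupportDomain (gauge K) S) where
  isOpen := hK.isPlaneNorm.isOpen_strictSupportDomain hS
  nonempty := hK.nonempty.mono (hK.subset_strictSupportDomain S)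
  convex := by
    have hlt : ∀ {a b s t c : ℝ}, 0 ≤ a → 0 ≤ b → a + b = 1 → s < c → t < c →
        a * s + b * t < c := by
      intro a b s t c ha hb hab hs ht
      obtain rfl : b = 1 - a := by linarith
      rcases ha.eq_or_lt with rfl | ha
      · linarith
      · nlinarith
    intro x hx y hy a b ha hb hab
    refine ⟨(hK.isPlaneNorm.combination_le ha hb x y).trans_lt (hlt ha hb hab hx.1 hy.1),
      fun u hu hs => ?_⟩
    rw [planeDet_add_right, planeDet_smul_right, planeDet_smul_right]
    exact hlt ha hb hab (hx.2 u hu hs) (hy.2 u hu hs)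
  isBounded := (hK.isPlaneNorm.isCompact_le 2).isBounded.subset fun x hx => hx.1.le
  neg_mem x hx := by
    refine ⟨by rw [hK.isPlaneNorm.neg]; exact hx.1, ?_⟩
    rintro u hu ⟨s, hs, hus⟩
    have hneg : ∀ y, planeDet (-u) y = -planeDet u y := by
      intro y; simp [planeDet]; ring
    rw [planeDet_neg_right, ← hneg]
    refine hx.2 (-u) (fun y => ?_) ⟨-s, hSneg s hs, ?_⟩
    · rw [hneg, ← planeDet_neg_right, ← hK.isPlaneNorm.neg]
      exact hu _
    · rw [hneg, planeDet_neg_right, neg_neg, hus]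

/-- A support at a point of `S` excludes that point; by strict convexity it touches the unit sphere
nowhere else, so it excludes no other unit vector. -/
theorem IsSymmetricConvexDomain.mem_strictSupportDomain_iff {K : Set (Fin 2 → ℝ)}
    (hK : IsSymmetricConvexDomain K) (hs : IsStrictNorm (gauge K)) {S : Set (Fin 2 → ℝ)}
    (hS : ∀ s ∈ S, gauge K s = 1) {x : Fin 2 → ℝ} (hx : gauge K x = 1) :
    x ∈ _root_.strictSupportDomain (gauge K) S ↔ x ∉ S := by
  constructor
  · intro h hxS
    obtain ⟨u, hu, hux⟩ := hK.isPlaneNorm.exists_support hx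
    exact (h.2 u hu ⟨x, hxS, hux⟩).ne hux
  · intro hxS
    refine ⟨by rw [hx]; norm_num, ?_⟩
    rintro u hu ⟨s, hsS, hus⟩
    by_contra! h
    exact hxS (hs.eq_of_support hu (hS s hsS) hx hus.ge h ▸ hsS)

theorem exists_criticalLocus_eq {H : Set (Fin 2 → ℝ)} (hH : IsSymmetricConvexDomain H)
    (hstrict : HasStrictlyConvexBoundary H) (hirr : IsIrreducibleDomain H)
    (Z : Set (criticalLocus H)) (hZ : Z.Nonempty) (hZc : IsClosed Z) :
    ∃ K : Set (Fin 2 → ℝ), IsSymmetricConvexDomain K ∧ H ⊆ K ∧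
      criticalLocus K = Subtype.val '' Z := by
  have hN := hH.isPlaneNorm
  have hs := hH.isStrictNorm hstrict
  obtain ⟨C, hC, rfl⟩ := isClosed_induced_iff.1 hZc
  have hcrit : ∀ {p q} (h : IsHexPair (gauge H) p q), h.lattice ∈ criticalLocus H := fun h =>
    (mem_criticalLocus_iff hH hstrict hirr).2 ⟨_, _, h, rfl⟩
  set S : Set (Fin 2 → ℝ) := {p | ∃ q, ∃ h : IsHexPair (gauge H) p q, h.lattice ∈ C} with hSdef
  have hS1 : ∀ s ∈ S, gauge H s = 1 := by
    rintro s ⟨q, h, -⟩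
    exact h.left
  have hSrot : ∀ {p q} (h : IsHexPair (gauge H) p q), h.lattice ∈ C →
      p ∈ S ∧ q ∈ S ∧ q - p ∈ S ∧ -p ∈ S := by
    intro p q h hC
    have h2 := h.rotate hN
    have h3 := h2.rotate hN
    have h4 := h3.rotate hN
    have hC2 : h2.lattice ∈ C := by rwa [h.lattice_rotate hN]
    have hC3 : h3.lattice ∈ C := by rwa [h2.lattice_rotate hN]
    have hC4 : h4.lattice ∈ C := by rwa [h3.lattice_rotate hN]
    refine ⟨⟨_, h, hC⟩, ⟨_, h2, hC2⟩, ⟨_, h3, hC3⟩, ?_⟩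
    have := (⟨_, h4, hC4⟩ : q - p - q ∈ S)
    rwa [sub_sub_cancel_left] at this
  have hSneg : ∀ s ∈ S, -s ∈ S := by
    rintro s ⟨q, h, hC⟩
    exact (hSrot h hC).2.2.2
  have hSc : IsCompact S := by
    have : CompactSpace {x : (Fin 2 → ℝ) × (Fin 2 → ℝ) // IsHexPair (gauge H) x.1 x.2} :=
      isCompact_iff_compactSpace.1 (isCompact_setOf_isHexPair hN)
    have hlc : Continuous fun x : {x : (Fin 2 → ℝ) × (Fin 2 → ℝ) //
        IsHexPair (gauge H) x.1 x.2} => x.2.lattice :=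
      continuous_latticeOfBasis.comp (continuous_subtype_val.subtype_mk _)
    have e : S = (fun x : {x : (Fin 2 → ℝ) × (Fin 2 → ℝ) // IsHexPair (gauge H) x.1 x.2} =>
        x.1.1) '' {x | x.2.lattice ∈ C} := by
      ext p
      constructor
      · rintro ⟨q, h, hC⟩
        exact ⟨⟨(p, q), h⟩, hC, rfl⟩
      · rintro ⟨⟨⟨p, q⟩, h⟩, hC, rfl⟩
        exact ⟨q, h, hC⟩
    rw [e]
    exact (hC.preimage hlc).isCompact.image (continuous_fst.comp continuous_subtype_val)
  set K := strictSupportDomain (gauge H) S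
  have hK : IsSymmetricConvexDomain K := hH.strictSupportDomain hSc hSneg
  have hHK : H ⊆ K := hH.subset_strictSupportDomain S
  have hgS : ∀ s ∈ S, gauge K s = 1 := by
    intro s hsS
    refine le_antisymm ((hH.gauge_le_of_subset hHK s).trans (hS1 s hsS).le) ?_
    by_contra! hlt
    exact (hH.mem_strictSupportDomain_iff hs hS1 (hS1 s hsS)).1 (hK.gauge_lt_one.1 hlt) hsS
  have hadm : ∀ {p q} (h : IsHexPair (gauge H) p q), IsAdmissible K h.lattice ↔ h.lattice ∈ C := by
    intro p q h
    constructor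
    · intro hadm
      by_contra hnot
      have hp : p ∉ S := by
        rintro ⟨q', h', hC'⟩
        obtain rfl := h.unique hN hs h'
        exact hnot hC'
      have hpK := (hH.mem_strictSupportDomain_iff hs hS1 h.left).2 hp
      have : p ∈ latticePoints h.lattice ∩ K := ⟨h.left_mem_lattice, hpK⟩
      rw [hadm] at this
      exact h.left_ne_zero this
    · intro hC
      have hS := hSrot h hC
      exact IsHexPair.isAdmissible hK ⟨hgS _ hS.1, hgS _ hS.2.1, hgS _ hS.2.2.1, h.pos⟩
  have hmono : ∀ {Λ}, IsAdmissible K Λ → IsAdmissible H Λ := by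
    intro Λ h
    rw [hH.isAdmissible_iff]
    intro x hx hx0
    exact (hK.isAdmissible_iff.1 h x hx hx0).trans (hH.gauge_le_of_subset hHK x)
  -- A lattice in `Z` gives `≤`; the inclusion `H ⊆ K` gives `≥`.
  have hΔ : criticalDeterminant K = criticalDeterminant H := by
    obtain ⟨⟨Λ, hΛ⟩, hΛC⟩ := hZ
    obtain ⟨p, q, h, rfl⟩ := (mem_criticalLocus_iff hH hstrict hirr).1 hΛ
    have hadmK := (hadm h).2 hΛC
    refine le_antisymm ((criticalDeterminant_le hadmK).trans hΛ.2.le) ?_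
    refine le_csInf ⟨_, _, hadmK, rfl⟩ ?_
    rintro _ ⟨Λ', hΛ', rfl⟩
    exact criticalDeterminant_le (hmono hΛ')
  refine ⟨K, hK, hHK, ?_⟩
  ext Λ
  constructor
  · rintro ⟨h1, h2⟩
    have hΛ : Λ ∈ criticalLocus H := ⟨hmono h1, h2.trans hΔ⟩
    obtain ⟨p, q, h, rfl⟩ := (mem_criticalLocus_iff hH hstrict hirr).1 hΛ
    exact ⟨⟨_, hΛ⟩, (hadm h).1 h1, rfl⟩
  · rintro ⟨⟨Λ, hΛ⟩, hΛC, rfl⟩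
    obtain ⟨p, q, h, rfl⟩ := (mem_criticalLocus_iff hH hstrict hirr).1 hΛ
    exact ⟨(hadm h).2 hΛC, by rw [hΔ]; exact hΛ.2⟩

theorem theorem1p6 (H : Set (Fin 2 → ℝ)) (hH : IsSymmetricConvexDomain H)
    (hstrict : HasStrictlyConvexBoundary H) (hirr : IsIrreducibleDomain H) :
    (∃ φ : Circle → LatticeSpace, Topology.IsEmbedding φ ∧ Set.range φ = criticalLocus H) ∧
    ∀ Z : Set (criticalLocus H), Z.Nonempty → IsClosed Z →
      ∃ K : Set (Fin 2 → ℝ), IsSymmetricConvexDomain K ∧ H ⊆ K ∧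
        criticalLocus K = Subtype.val '' Z :=
  ⟨exists_embedding_circle hH hstrict hirr, exists_criticalLocus_eq hH hstrict hirr⟩
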